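/- Let $R$ be a generalized Cohen--Kaplansky domain, i.e. an integral domain which is atomic (every nonzero non-unit is a finite product of atoms) and which has, up to associates, only finitely many atoms that are not prime elements. Let $K$ be the quotient field of $R$ and $\overline R$ the integral closure of $R$ in $K$. For a domain $D$ let $\mathcal A(D)$ be the set of atoms (irreducible elements) of $D$, $D^\times$ its group of units, and $D^\bullet=D\setminus\{0\}$ its multiplicative monoid of nonzero elements; $D$ is called transfer Krull, half-factorial or seminormal if the monoid $D^\bullet$ is. Here, for a commutative cancellative monoid $H$ with quotient group $\mathsf q(H)$: - $H$ is half-factorial if every non-unit is a finite product of atoms and any two factorizations of an element into atoms have the same number of factors; - $H$ is Krull if it is completely integrally closed and satisfies the ascending chain condition on $t$-ideals; - a monoid homomorphism $\theta\colon H\to B$ is a transfer homomorphism if $B=\theta(H)B^\times$, $\theta^{-1}(B^\times)=H^\times$, and whenever $\theta(u)=bc$ with $u\in H$, $b,c\in B$, there are $v,w\in H$ and $\varepsilon,\eta\in B^\times$ with $u=vw$, $\theta(v)=b\varepsilon$, $\theta(w)=c\eta$; - $H$ is transfer Krull if there is a transfer homomorphism from $H$ to a (commutative, cancellative) Krull monoid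 $B$; - $H$ is seminormal if every $x\in\mathsf q(H)$ with $x^n\in H$ for all sufficiently large $n$ lies in $H$. Then the following statements are equivalent. 1. $R$ is transfer Krull. 2. $R_M$ is transfer Krull for each maximal ideal $M$ of $R$. 3. $R_M$ is half-factorial for each maximal ideal $M$ of $R$. 4. $R$ is half-factorial. 5. $\mathcal A(\overline R)=\{u\varepsilon\mid u\in\mathcal A(R),\ \varepsilon\in\overline R^\times\}$. 6. $\mathcal A(R)\subseteq\mathcal A(\overline R)$. In addition, if $R$ is seminormal, then these equivalent conditions are satisfied. -/

import Mathlib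

open scoped nonZeroDivisors

universe u

namespace FactorizationTheory

section Monoid

variable (H : Type u) [CommMonoid H]

/-- The quotient group `K` of `H`. -/
abbrev QuotientGroup : Type u := Algebra.GrothendieckGroup H

/-- The image of `H` in its quotient group `K` (a copy of `H` when `H` is cancellative). -/
def imageInQuotient : Submonoid (QuotientGroup H) :=
  MonoidHom.mrange (Algebra.GrothendieckGroup.of (M := H))

/-- `(H : A) = {z ∈ K ∣ z A ⊆ H}`, for `A ⊆ K`. -/
def inverseSet (A : Set (QuotientGroup H)) : Set (QuotientGroup H) :=
  {z | ∀ a ∈ A, z * a ∈ imageInQuotient H}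

/-- `A_v = (H : (H : A))`. -/
def vClosure (A : Set (QuotientGroup H)) : Set (QuotientGroup H) :=
  inverseSet H (inverseSet H A)

/-- `A_t`, the union of the sets `E_v` over the finite subsets `E` of `A`. -/
def tClosure (A : Set (QuotientGroup H)) : Set (QuotientGroup H) :=
  {x | ∃ E : Set (QuotientGroup H), E.Finite ∧ E ⊆ A ∧ x ∈ vClosure H E}

/-- `A` is a `t`-ideal of `H`: `A ⊆ H` and `A_t = A`. -/
def IsTIdeal (A : Set (QuotientGroup H)) : Prop :=
  A ⊆ imageInQuotient H ∧ tClosure H A = A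

/-- `H` is Mori: the ascending chain condition holds for the `t`-ideals of `H`. -/
def IsMori : Prop :=
  ∀ I : ℕ → Set (QuotientGroup H), (∀ n, IsTIdeal H (I n)) → Monotone I →
    ∃ n, ∀ m, n ≤ m → I m = I n

/-- `H` is completely integrally closed: every `x ∈ K` for which there is some `c ∈ H` with
`c x ^ n ∈ H` for all `n ≥ 1` lies in `H`. -/
def IsCompletelyIntegrallyClosed : Prop :=
  ∀ x : QuotientGroup H,
    (∃ c ∈ imageInQuotient H, ∀ n : ℕ, 1 ≤ n → c * x ^ n ∈ imageInQuotient H) →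
      x ∈ imageInQuotient H

/-- `H` is a Krull monoid. -/
def IsKrull : Prop := IsCompletelyIntegrallyClosed H ∧ IsMori H

/-- `H` is seminormal: every `x ∈ K` with `x ^ n ∈ H` for all sufficiently large `n` lies
in `H`. -/
def IsSeminormal : Prop :=
  ∀ x : QuotientGroup H,
    (∃ N : ℕ, 1 ≤ N ∧ ∀ n, N ≤ n → x ^ n ∈ imageInQuotient H) → x ∈ imageInQuotient H

/-- `H` is atomic: every non-unit is a finite product of atoms (`Irreducible` elements). -/
def IsAtomicMonoid : Prop :=
  ∀ a : H, ¬ IsUnit a → ∃ s : Multiset H, (∀ x ∈ s, Irreducible x) ∧ s.prod = a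

variable {H} in
/-- The set of lengths `L(a)`: the numbers `k` such that `a` is a product of `k` atoms if `a` is
a non-unit, and `{0}` if `a` is a unit. -/
def setOfLengths (a : H) : Set ℕ :=
  {k | (IsUnit a ∧ k = 0) ∨
    (¬ IsUnit a ∧ 1 ≤ k ∧
      ∃ s : Multiset H, (∀ x ∈ s, Irreducible x) ∧ s.card = k ∧ s.prod = a)}

/-- `H` is half-factorial: it is atomic and `|L(a)| = 1` for all `a ∈ H`. -/
def IsHalfFactorial : Prop :=
  IsAtomicMonoid H ∧ ∀ a : H, ∃! k : ℕ, k ∈ setOfLengths a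

end Monoid

/-- `θ : H → B` is a transfer homomorphism. -/
structure IsTransferHom {H B : Type*} [CommMonoid H] [CommMonoid B] (θ : H →* B) : Prop where
  /-- `B = θ(H) Bˣ` -/
  exists_eq_mul_unit : ∀ b : B, ∃ (a : H) (ε : Bˣ), b = θ a * ε
  /-- `θ⁻¹(Bˣ) = Hˣ` -/
  isUnit_iff : ∀ a : H, IsUnit (θ a) ↔ IsUnit a
  /-- factorizations lift along `θ` -/
  exists_lift : ∀ (a : H) (b c : B), θ a = b * c →
    ∃ (v w : H) (ε η : Bˣ), a = v * w ∧ θ v = b * ε ∧ θ w = c * η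

/-- `H` is transfer Krull: there is a transfer homomorphism from `H` to a (cancellative,
commutative) Krull monoid `B`. Taking `B` in the universe of `H` is no restriction: `B` may be
replaced by the Krull monoid `B / Bˣ`, onto which `H` maps surjectively. -/
def IsTransferKrull (H : Type u) [CommMonoid H] : Prop :=
  ∃ (B : Type u) (_ : CancelCommMonoid B) (θ : H →* B), IsKrull B ∧ IsTransferHom θ

/-- A domain `R` is a generalized Cohen–Kaplansky domain: the monoid `R⁰` of nonzero elements is
atomic, and up to associates only finitely many atoms of `R` are not prime elements. -/
def IsGeneralizedCohenKaplansky (R : Type*) [CommRing R] [IsDomain R] : Prop :=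
  IsAtomicMonoid R⁰ ∧
    {c : Associates R | ∃ a : R, Irreducible a ∧ ¬ Prime a ∧ Associates.mk a = c}.Finite

end FactorizationTheory

open FactorizationTheory

/-!
The domain `R` enters only through two properties. First, atoms are primary: if an atom `a` divides
`x * y`, then it divides `x` or a power of `y` (`IsGeneralizedCohenKaplansky.hasPrimaryAtoms`).
Inverting the prime elements leaves a domain with finitely many atoms and hence finitely many
maximal ideals. There, Dickson's lemma applied to the elements `a + yⁿ` shows that an atom divides a
power of every element of the Jacobson radical. For arbitrary `y`, the atom `a` divides a power of
`y * f` for some `f` comaximal to `y`, so the ideal `(a)` is the product of `(a, yⁿ)` and `(a, fⁿ)`.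
These are invertible, so they are principal in a semilocal domain, and one of them is trivial.

Second, two atoms that divide powers of each other have associated powers
(`HasPrimaryAtoms.exists_associated_pow`), and the exponent on one side can be chosen uniformly
(`IsGeneralizedCohenKaplansky.exists_isCommonExponent`). Writing `bⁿ = aᵏ t` with `a ∤ t`, there are
only finitely many `t` up to units, and comparing two values of `n` with the same `t` gives the
relation. Hence each class of atoms defines a valuation, up to scaling (`rootOrd`), and these
valuations determine divisibility up to powers. So an element of `K` is integral over `R` if and
only if all of them are nonnegative at it (`HasPrimaryAtoms.isIntegral_div_iff`).

All conditions of the theorem are equivalent to `EqualExponents R`: if `aᵐ` and `bⁿ` are associated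
for atoms `a`, `b` and positive `m`, `n`, then `m = n`. This holds in every root closed monoid, in
particular in Krull monoids and in the integral closure, and it is inherited along transfer
homomorphisms; seminormal monoids satisfy it too. Atoms of `R` remain atoms in `R_M` for every
maximal ideal `M` that contains them, so the local conditions imply it as well. Conversely, under
`EqualExponents R` all atoms in a class have the same valuation. Then the valuations count the
atoms of each class in a factorization, so that `R` and its localizations are half-factorial, and an
atom has the least positive valuation in its class, so that it is an atom of the integral closure.
Finally, the length function makes half-factorial monoids transfer Krull.
-/

namespace FactorizationTheory

/-! ### Domains with finitely many atoms -/

section CohenKaplansky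

variable {D : Type*} [CommRing D] {ι : Type*} [Fintype ι] {A : ι → D}

/-- If every nonzero element is associated to a monomial in finitely many fixed elements, then
there are only finitely many maximal ideals: each is determined by the fixed elements it contains. -/
theorem finite_isMaximal_of_forall_associated
    (hA : ∀ x : D, x ≠ 0 → ∃ e : ι → ℕ, Associated x (∏ i, A i ^ e i)) :
    {I : Ideal D | I.IsMaximal}.Finite := by
  refine Set.Finite.of_finite_image (f := fun I : Ideal D => {i | A i ∈ I}) (Set.toFinite _) ?_
  intro I hI J hJ hIJ
  refine Ideal.IsMaximal.eq_of_le hI hJ.ne_top fun x hx => ?_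
  rcases eq_or_ne x 0 with rfl | hx0
  · exact J.zero_mem
  obtain ⟨e, he⟩ := hA x hx0
  have h1 : ∏ i, A i ^ e i ∈ I := I.mem_of_dvd he.dvd hx
  have := hI.isPrime
  obtain ⟨i, -, hi⟩ := (Ideal.IsPrime.prod_mem_iff).1 h1
  have h2 : A i ∈ J := by
    have : i ∈ {i | A i ∈ I} := this.mem_of_pow_mem _ hi
    rw [show {i | A i ∈ I} = {i | A i ∈ J} from hIJ] at this
    exact this
  have hei : e i ≠ 0 := by
    rintro h
    rw [h, pow_zero] at hi
    exact hI.ne_top ((Ideal.eq_top_iff_one _).2 hi)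
  exact J.mem_of_dvd (((dvd_pow_self _ hei).trans
    (Finset.dvd_prod_of_mem (fun i => A i ^ e i) (Finset.mem_univ i))).trans he.symm.dvd) h2

/-- Among infinitely many nonzero elements, one divides a later one (Dickson's lemma). -/
theorem exists_lt_dvd_of_forall_associated
    (hA : ∀ x : D, x ≠ 0 → ∃ e : ι → ℕ, Associated x (∏ i, A i ^ e i))
    (z : ℕ → D) (hz : ∀ n, z n ≠ 0) : ∃ m n, m < n ∧ z m ∣ z n := by
  choose e he using fun n => hA (z n) (hz n)
  obtain ⟨m, n, hmn, hle⟩ := wellQuasiOrdered_le e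
  refine ⟨m, n, hmn, (he m).dvd.trans (dvd_trans ?_ (he n).symm.dvd)⟩
  exact Finset.prod_dvd_prod_of_dvd _ _ fun i _ => pow_dvd_pow _ (hle i)

/-- Every atom `a` divides a power of each element `y` of the Jacobson radical: some `a + yᵐ`
divides a later `a + yⁿ`, hence divides `yᵐ (1 - yⁿ⁻ᵐ)`, where the second factor is a unit, so it
divides `yᵐ` and `a`. -/
theorem exists_dvd_pow_of_mem_jacobson
    (hA : ∀ x : D, x ≠ 0 → ∃ e : ι → ℕ, Associated x (∏ i, A i ^ e i))
    {a y : D} (ha : Irreducible a) (hy : ∀ I : Ideal D, I.IsMaximal → y ∈ I) :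
    ∃ n, a ∣ y ^ n := by
  by_cases hz : ∃ n, a + y ^ (n + 1) = 0
  · obtain ⟨n, hn⟩ := hz
    exact ⟨n + 1, -1, by linear_combination hn⟩
  push Not at hz
  obtain ⟨m, n, hmn, hd⟩ := exists_lt_dvd_of_forall_associated hA _ hz
  obtain ⟨k, rfl⟩ : ∃ k, n = m + (k + 1) := ⟨n - m - 1, by omega⟩
  have hu : IsUnit (1 - y ^ (k + 1)) := by
    by_contra h
    obtain ⟨I, hI, hmem⟩ := exists_max_ideal_of_mem_nonunits h
    have h2 : y ^ (k + 1) ∈ I := I.pow_mem_of_mem (hy I hI) _ k.succ_pos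
    exact hI.ne_top ((Ideal.eq_top_iff_one _).2 (by simpa using I.add_mem hmem h2))
  have h1 : a + y ^ (m + 1) ∣ y ^ (m + 1) * (1 - y ^ (k + 1)) := by
    have := dvd_sub (dvd_refl (a + y ^ (m + 1))) hd
    convert this using 1
    ring
  have h2 : a + y ^ (m + 1) ∣ y ^ (m + 1) := (hu.dvd_mul_right).1 h1
  have h3 : a + y ^ (m + 1) ∣ a := (dvd_add_left h2).1 dvd_rfl
  refine ⟨m + 1, ?_⟩
  rcases (ha.dvd_iff).1 h3 with h | h
  · obtain ⟨I, hI, hmem⟩ := exists_max_ideal_of_mem_nonunits ha.not_isUnit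
    exact absurd (I.eq_top_of_isUnit_mem
      (I.add_mem hmem (I.pow_mem_of_mem (hy I hI) _ m.succ_pos)) h) hI.ne_top
  · exact h.dvd.trans h2

variable [IsDomain D]

/-- In a domain with finitely many maximal ideals, an atom `a` that divides a power of `y * f`,
where `y` and `f` are comaximal, divides a power of `y` or is comaximal to `y`. Indeed, the ideals
`(a, yⁿ)` and `(a, fⁿ)` have product `(a)`, so they are invertible, hence principal, and one of
them is the unit ideal. -/
theorem dvd_pow_or_isCoprime_of_dvd_pow_mul
    (hfin : {I : Ideal D | I.IsMaximal}.Finite) {a y f : D} (ha : Irreducible a)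
    (hyf : IsCoprime y f) {n : ℕ} (hn : a ∣ (y * f) ^ n) :
    a ∣ y ^ n ∨ IsCoprime a y := by
  obtain ⟨p, q, hpq⟩ := hyf.pow (m := n) (n := n)
  have hprod : Ideal.span {a, y ^ n} * Ideal.span {a, f ^ n} = Ideal.span {a} := by
    apply le_antisymm
    · rw [Ideal.span_mul_span', Ideal.span_le]
      rintro _ ⟨s, hs, t, ht, rfl⟩
      simp only [Set.mem_insert_iff, Set.mem_singleton_iff] at hs ht
      rw [SetLike.mem_coe, Ideal.mem_span_singleton]
      rcases hs with rfl | rfl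
      · exact dvd_mul_right _ _
      rcases ht with rfl | rfl
      · exact dvd_mul_left _ _
      · show a ∣ y ^ n * f ^ n
        rwa [← mul_pow]
    · rw [Ideal.span_singleton_le_iff_mem]
      have h1 : y ^ n * a ∈ Ideal.span {a, y ^ n} * Ideal.span {a, f ^ n} :=
        Ideal.mul_mem_mul (Ideal.subset_span (by simp)) (Ideal.subset_span (by simp))
      have h2 : a * f ^ n ∈ Ideal.span {a, y ^ n} * Ideal.span {a, f ^ n} :=
        Ideal.mul_mem_mul (Ideal.subset_span (by simp)) (Ideal.subset_span (by simp))
      have h3 := Ideal.add_mem _ (Ideal.mul_mem_left _ p h1) (Ideal.mul_mem_left _ q h2)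
      rwa [show p * (y ^ n * a) + q * (a * f ^ n) = a by linear_combination a * hpq] at h3
  have hinv : IsUnit (((Ideal.span {a, y ^ n} : Ideal D) * (Ideal.span {a, f ^ n} : Ideal D) :
      Ideal D) : FractionalIdeal D⁰ (FractionRing D)) := by
    rw [hprod]
    exact .of_mul_eq_one _ (FractionalIdeal.coe_ideal_span_singleton_mul_inv _ ha.ne_zero)
  rw [FractionalIdeal.coeIdeal_mul, IsUnit.mul_iff] at hinv
  obtain ⟨b, hb⟩ := (Ideal.IsPrincipal.of_finite_maximals_of_isUnit hfin hinv.1).principal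
  obtain ⟨c, hc⟩ := (Ideal.IsPrincipal.of_finite_maximals_of_isUnit hfin hinv.2).principal
  change _ = Ideal.span {b} at hb
  change _ = Ideal.span {c} at hc
  rw [hb, hc, Ideal.span_singleton_mul_span_singleton, Ideal.span_singleton_eq_span_singleton]
    at hprod
  have hirr := hprod.irreducible_iff.2 ha
  rcases hirr.isUnit_or_isUnit rfl with h | h
  · right
    rw [Ideal.span_singleton_eq_top.2 h, Ideal.eq_top_iff_one, Ideal.mem_span_pair] at hb
    obtain ⟨s, t, hst⟩ := hb
    rcases n.eq_zero_or_pos with rfl | hpos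
    · rw [pow_zero] at hn
      exact absurd (isUnit_of_dvd_one hn) ha.not_isUnit
    · exact (IsCoprime.pow_right_iff hpos).1 ⟨s, t, hst⟩
  · left
    have h1 : y ^ n ∈ Ideal.span {b} := hb ▸ Ideal.subset_span (by simp)
    rw [Ideal.mem_span_singleton] at h1
    exact ((associated_mul_unit_right b c h).trans hprod).symm.dvd.trans h1

/-- In a domain with finitely many atoms, an atom divides a power of `y` or is comaximal
to `y`. -/
theorem exists_dvd_pow_or_isCoprime
    (hA : ∀ x : D, x ≠ 0 → ∃ e : ι → ℕ, Associated x (∏ i, A i ^ e i))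
    {a : D} (ha : Irreducible a) (y : D) : (∃ n, a ∣ y ^ n) ∨ IsCoprime a y := by
  have hfin := finite_isMaximal_of_forall_associated hA
  -- `f` lies in every maximal ideal that does not contain `y`, so `y * f` lies in all of them.
  obtain ⟨f, hyf, hf⟩ : ∃ f, IsCoprime y f ∧ ∀ I : Ideal D, I.IsMaximal → y ∉ I → f ∈ I := by
    classical
    set s : Finset (Ideal D) := {I ∈ hfin.toFinset | y ∉ I} with hs
    have htop : Ideal.span {y} ⊔ s.inf id = ⊤ := by
      by_contra h
      obtain ⟨I, hI, hle⟩ := Ideal.exists_le_maximal _ h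
      have := hI.isPrime
      obtain ⟨J, hJ, hJI⟩ := (Ideal.IsPrime.inf_le' this).1 (le_sup_right.trans hle)
      rw [hs, Finset.mem_filter, Set.Finite.mem_toFinset] at hJ
      have hJI' : J = I := Ideal.IsMaximal.eq_of_le hJ.1 hI.ne_top hJI
      exact hJ.2 (hJI' ▸ (Ideal.span_singleton_le_iff_mem _).1 (le_sup_left.trans hle))
    rw [Ideal.eq_top_iff_one, Submodule.mem_sup] at htop
    obtain ⟨u, hu, f, hf, huf⟩ := htop
    obtain ⟨v, rfl⟩ := Ideal.mem_span_singleton'.1 hu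
    refine ⟨f, ⟨v, 1, by simpa using huf⟩, fun I hI hyI => ?_⟩
    have hle : s.inf id ≤ I := Finset.inf_le (f := id) (by simpa [hs, hyI] using hI)
    exact hle hf
  obtain ⟨n, hn⟩ := exists_dvd_pow_of_mem_jacobson hA ha (y := y * f) fun I hI => by
    by_cases h : y ∈ I
    · exact I.mul_mem_right _ h
    · exact I.mul_mem_left _ (hf I hI h)
  exact (dvd_pow_or_isCoprime_of_dvd_pow_mul hfin ha hyf hn).imp_left fun h => ⟨n, h⟩

end CohenKaplansky

/-! ### Atoms of the monoid of nonzero elements -/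

section NonZero

variable {D : Type*} [CommRing D] [IsDomain D]

theorem isUnit_nonZeroDivisors_iff (x : D⁰) : IsUnit x ↔ IsUnit (x : D) := by
  refine ⟨fun h => h.map (Submonoid.subtype D⁰), fun h => ?_⟩
  obtain ⟨y, hy⟩ := isUnit_iff_exists_inv.1 h
  have hy0 : y ∈ D⁰ := mem_nonZeroDivisors_of_ne_zero (right_ne_zero_of_mul_eq_one hy)
  exact isUnit_iff_exists_inv.2 ⟨⟨y, hy0⟩, Subtype.ext hy⟩

theorem irreducible_nonZeroDivisors_iff (x : D⁰) : Irreducible x ↔ Irreducible (x : D) := by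
  rw [irreducible_iff, irreducible_iff, isUnit_nonZeroDivisors_iff]
  refine and_congr_right fun _ => ⟨fun h a b hab => ?_, fun h a b hab => ?_⟩
  · have h0 : a * b ≠ 0 := hab ▸ nonZeroDivisors.coe_ne_zero x
    have := h (a := ⟨a, mem_nonZeroDivisors_of_ne_zero (left_ne_zero_of_mul h0)⟩)
      (b := ⟨b, mem_nonZeroDivisors_of_ne_zero (right_ne_zero_of_mul h0)⟩) (Subtype.ext hab)
    simpa only [isUnit_nonZeroDivisors_iff] using this
  · simpa only [isUnit_nonZeroDivisors_iff] using h (congrArg Subtype.val hab)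

theorem dvd_nonZeroDivisors_iff (x y : D⁰) : x ∣ y ↔ (x : D) ∣ y := by
  refine ⟨fun h => map_dvd (Submonoid.subtype D⁰) h, fun ⟨z, hz⟩ => ?_⟩
  have h0 : (x : D) * z ≠ 0 := hz ▸ nonZeroDivisors.coe_ne_zero y
  exact ⟨⟨z, mem_nonZeroDivisors_of_ne_zero (right_ne_zero_of_mul h0)⟩, Subtype.ext hz⟩

theorem associated_nonZeroDivisors_iff (x y : D⁰) : Associated x y ↔ Associated (x : D) y := by
  refine ⟨fun h => h.map (Submonoid.subtype D⁰), fun ⟨u, hu⟩ => ?_⟩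
  obtain ⟨v, hv⟩ := (isUnit_nonZeroDivisors_iff
    ⟨(u : D), mem_nonZeroDivisors_of_ne_zero u.ne_zero⟩).2 u.isUnit
  exact ⟨v, by rw [hv]; exact Subtype.ext hu⟩

instance isCancelMul_nonZeroDivisors : IsCancelMul D⁰ where
  mul_left_cancel a _ _ hbc := Subtype.ext
    (mul_left_cancel₀ (nonZeroDivisors.coe_ne_zero a) (congrArg Subtype.val hbc))
  mul_right_cancel a _ _ hbc := Subtype.ext
    (mul_right_cancel₀ (nonZeroDivisors.coe_ne_zero a) (congrArg Subtype.val hbc))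

/-- A multiset of atoms of `D` is a multiset of atoms of `D⁰`. -/
theorem exists_multiset_nonZeroDivisors (s : Multiset D) (hs : ∀ x ∈ s, Irreducible x) :
    ∃ t : Multiset D⁰, t.map (↑) = s ∧ ∀ x ∈ t, Irreducible x := by
  refine ⟨s.pmap (fun x hx => ⟨x, hx⟩) fun x hx => mem_nonZeroDivisors_of_ne_zero (hs x hx).ne_zero,
    by rw [Multiset.map_pmap, Multiset.pmap_eq_map, Multiset.map_id'], ?_⟩
  intro x hx
  obtain ⟨a, ha, rfl⟩ := Multiset.mem_pmap.1 hx
  exact (irreducible_nonZeroDivisors_iff _).2 (hs a ha)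

theorem isAtomicMonoid_nonZeroDivisors_iff :
    IsAtomicMonoid D⁰ ↔ ∀ x : D, x ≠ 0 → ¬ IsUnit x →
      ∃ s : Multiset D, (∀ a ∈ s, Irreducible a) ∧ s.prod = x := by
  constructor
  · intro h x hx hu
    obtain ⟨s, hs, hsx⟩ := h ⟨x, mem_nonZeroDivisors_of_ne_zero hx⟩
      fun h' => hu ((isUnit_nonZeroDivisors_iff _).1 h')
    refine ⟨s.map (↑), fun a ha => ?_, ?_⟩
    · obtain ⟨b, hb, rfl⟩ := Multiset.mem_map.1 ha
      exact (irreducible_nonZeroDivisors_iff _).1 (hs b hb)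
    · have := congrArg (Submonoid.subtype D⁰) hsx
      rwa [map_multiset_prod] at this
  · intro h x hu
    obtain ⟨s, hs, hsx⟩ := h x (nonZeroDivisors.coe_ne_zero x)
      fun h' => hu ((isUnit_nonZeroDivisors_iff _).2 h')
    obtain ⟨t, rfl, ht⟩ := exists_multiset_nonZeroDivisors s hs
    refine ⟨t, ht, Subtype.ext ?_⟩
    rw [← hsx]
    exact map_multiset_prod (Submonoid.subtype D⁰) t

end NonZero

/-! ### Atoms of generalized Cohen–Kaplansky domains are primary -/

section PrimaryAtoms

/-- A domain with primary atoms: every nonzero nonunit is a product of atoms, and every atom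
generates a primary ideal. -/
structure HasPrimaryAtoms (R : Type*) [CommRing R] : Prop where
  exists_factors : ∀ x : R, x ≠ 0 → ¬ IsUnit x →
    ∃ s : Multiset R, (∀ a ∈ s, Irreducible a) ∧ s.prod = x
  dvd_or_dvd_pow : ∀ {a : R}, Irreducible a → ∀ {x y : R}, a ∣ x * y → a ∣ x ∨ ∃ n, a ∣ y ^ n

variable {R : Type*} [CommRing R] [IsDomain R]

/-- The multiplicative set generated by the prime elements. -/
def primeProducts (R : Type*) [CommRing R] : Submonoid R := Submonoid.closure {p | Prime p}

theorem primeProducts_le_nonZeroDivisors : primeProducts R ≤ R⁰ :=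
  (Submonoid.closure_le).2 fun _ hp => mem_nonZeroDivisors_of_ne_zero (Prime.ne_zero hp)

theorem dvd_of_dvd_mul_of_mem_primeProducts {x s : R} (hx : ∀ p, Prime p → ¬ p ∣ x)
    (hs : s ∈ primeProducts R) : ∀ {y : R}, x ∣ y * s → x ∣ y := by
  induction hs using Submonoid.closure_induction with
  | one => simp
  | mem p hp =>
    rintro y ⟨z, hz⟩
    obtain ⟨w, rfl⟩ := ((Prime.dvd_or_dvd hp (Dvd.intro_left y hz)).resolve_left (hx p hp))
    exact ⟨w, mul_right_cancel₀ (Prime.ne_zero hp) (by rw [hz]; ring)⟩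
  | mul s t _ _ hs ht =>
    intro y h
    exact hs (ht (by rwa [← mul_assoc] at h))

/-- Divisibility by an element without prime divisors is not affected by inverting primes. -/
theorem dvd_of_algebraMap_dvd {D : Type*} [CommRing D] [Algebra R D]
    [IsLocalization (primeProducts R) D] {x y : R} (hx : ∀ p, Prime p → ¬ p ∣ x)
    (h : algebraMap R D x ∣ algebraMap R D y) : x ∣ y := by
  obtain ⟨z, hz⟩ := h
  obtain ⟨⟨r, s⟩, hrs⟩ := IsLocalization.surj (primeProducts R) z
  refine dvd_of_dvd_mul_of_mem_primeProducts hx s.2 ⟨r, ?_⟩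
  apply IsLocalization.injective D primeProducts_le_nonZeroDivisors
  rw [map_mul, map_mul, hz, mul_assoc, hrs]

section

variable {ι : Type*} [Fintype ι] {A : ι → R}

omit [IsDomain R] in
/-- If `A` represents the atoms that are not prime, then every nonzero element is a monomial in
`A` times a product of primes, up to a unit. -/
theorem exists_associated_prod_mul
    (hatom : ∀ x : R, x ≠ 0 → ¬ IsUnit x →
      ∃ s : Multiset R, (∀ a ∈ s, Irreducible a) ∧ s.prod = x)
    (hA : ∀ a : R, Irreducible a → ¬ Prime a → ∃ i, Associated a (A i)) {x : R} (hx : x ≠ 0) :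
    ∃ e : ι → ℕ, ∃ s ∈ primeProducts R, Associated x ((∏ i, A i ^ e i) * s) := by
  classical
  by_cases hu : IsUnit x
  · exact ⟨0, 1, one_mem _, by simpa using associated_one_iff_isUnit.2 hu⟩
  obtain ⟨s, hs, rfl⟩ := hatom x hx hu
  clear hx hu
  induction s using Multiset.induction_on with
  | empty => exact ⟨0, 1, one_mem _, by simp⟩
  | cons a t ih =>
    obtain ⟨e, s, hs', h⟩ := ih fun b hb => hs b (Multiset.mem_cons_of_mem hb)
    rw [Multiset.prod_cons]
    by_cases hp : Prime a
    · refine ⟨e, a * s, mul_mem (Submonoid.subset_closure hp) hs', ?_⟩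
      rw [mul_left_comm]
      exact h.mul_left a
    · obtain ⟨i, hi⟩ := hA a (hs a (Multiset.mem_cons_self a t)) hp
      refine ⟨e + Pi.single i 1, s, hs', ?_⟩
      have : ∏ j, A j ^ (e + Pi.single i 1 : ι → ℕ) j = A i * ∏ j, A j ^ e j := by
        simp only [Pi.add_apply, pow_add, Finset.prod_mul_distrib]
        rw [mul_comm]
        congr 1
        rw [Finset.prod_eq_single i] <;> simp +contextual
      rw [this, mul_assoc]
      exact hi.mul_mul h

variable (hirr : ∀ i, Irreducible (A i) ∧ ¬ Prime (A i))
include hirr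

theorem not_prime_dvd_prod_pow (e : ι → ℕ) {p : R} (hp : Prime p) : ¬ p ∣ ∏ i, A i ^ e i := by
  intro h
  obtain ⟨i, -, hi⟩ := (Prime.dvd_finsetProd_iff hp _).1 h
  exact (hirr i).2 ((hp.irreducible.associated_of_dvd (hirr i).1 (hp.dvd_of_dvd_pow hi)).prime hp)

variable {D : Type*} [CommRing D] [Algebra R D] [IsLocalization (primeProducts R) D]

omit [IsDomain R] hirr in
/-- After inverting the prime elements, the nonzero elements are the monomials in the atoms that
are not prime, up to units. -/
theorem exists_associated_algebraMap_prod
    (hatom : ∀ x : R, x ≠ 0 → ¬ IsUnit x →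
      ∃ s : Multiset R, (∀ a ∈ s, Irreducible a) ∧ s.prod = x)
    (hA : ∀ a : R, Irreducible a → ¬ Prime a → ∃ i, Associated a (A i)) {z : D} (hz : z ≠ 0) :
    ∃ e : ι → ℕ, Associated z (algebraMap R D (∏ i, A i ^ e i)) := by
  obtain ⟨r, s, rfl⟩ := IsLocalization.exists_mk'_eq (primeProducts R) z
  have hr : r ≠ 0 := by
    rintro rfl
    exact hz (IsLocalization.mk'_zero s)
  obtain ⟨e, t, ht, h⟩ := exists_associated_prod_mul hatom hA hr
  refine ⟨e, ?_⟩
  have h1 : Associated (IsLocalization.mk' D r s) (algebraMap R D r) :=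
    ⟨(IsLocalization.map_units D s).unit, by simp⟩
  have h2 := h.map (algebraMap R D)
  rw [map_mul] at h2
  exact h1.trans (h2.trans (associated_mul_unit_left _ _ (IsLocalization.map_units D ⟨t, ht⟩)))

/-- Inverting the prime elements keeps the other atoms irreducible. -/
theorem irreducible_algebraMap_of_not_prime
    (hatom : ∀ x : R, x ≠ 0 → ¬ IsUnit x →
      ∃ s : Multiset R, (∀ a ∈ s, Irreducible a) ∧ s.prod = x)
    (hA : ∀ a : R, Irreducible a → ¬ Prime a → ∃ i, Associated a (A i)) {a : R}
    (ha : Irreducible a) (hap : ¬ Prime a) : Irreducible (algebraMap R D a) := by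
  have hnp : ∀ p, Prime p → ¬ p ∣ a := fun p hp h =>
    hap ((hp.irreducible.associated_of_dvd ha h).prime hp)
  have hinj := IsLocalization.injective D (primeProducts_le_nonZeroDivisors (R := R))
  refine ⟨fun h => ha.not_isUnit ?_, fun β γ h => ?_⟩
  · rw [isUnit_iff_dvd_one]
    refine dvd_of_algebraMap_dvd (D := D) hnp ?_
    rw [map_one]
    exact isUnit_iff_dvd_one.1 h
  · have ha0 : algebraMap R D a ≠ 0 := (map_ne_zero_iff _ hinj).2 ha.ne_zero
    rw [h] at ha0
    obtain ⟨e, he⟩ := exists_associated_algebraMap_prod hatom hA (left_ne_zero_of_mul ha0)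
    obtain ⟨f, hf⟩ := exists_associated_algebraMap_prod hatom hA (right_ne_zero_of_mul ha0)
    have hassoc : Associated (algebraMap R D a)
        (algebraMap R D (∏ i, A i ^ (e + f) i)) := by
      rw [h]
      have : ∏ i, A i ^ (e + f) i = (∏ i, A i ^ e i) * ∏ i, A i ^ f i := by
        simp [pow_add, Finset.prod_mul_distrib]
      rw [this, map_mul]
      exact he.mul_mul hf
    have h1 : Associated a (∏ i, A i ^ (e + f) i) :=
      associated_of_dvd_dvd (dvd_of_algebraMap_dvd hnp hassoc.dvd)
        (dvd_of_algebraMap_dvd (fun p hp => not_prime_dvd_prod_pow hirr _ hp) hassoc.symm.dvd)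
    have h2 := h1.irreducible_iff.1 ha
    have : ∏ i, A i ^ (e + f) i = (∏ i, A i ^ e i) * ∏ i, A i ^ f i := by
      simp [pow_add, Finset.prod_mul_distrib]
    rcases h2.isUnit_or_isUnit this with hu | hu
    · exact Or.inl (he.isUnit_iff.2 (hu.map _))
    · exact Or.inr (hf.isUnit_iff.2 (hu.map _))

end

/-- In a generalized Cohen–Kaplansky domain, atoms are primary. For an atom that is not prime this
can be checked after inverting the prime elements, where there are only finitely many atoms. -/
theorem IsGeneralizedCohenKaplansky.hasPrimaryAtoms (hR : IsGeneralizedCohenKaplansky R) :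
    HasPrimaryAtoms R := by
  have hatom := isAtomicMonoid_nonZeroDivisors_iff.1 hR.1
  refine ⟨hatom, fun {a} ha x y hxy => ?_⟩
  by_cases hap : Prime a
  · exact (hap.dvd_or_dvd hxy).imp_right fun h => ⟨1, by simpa using h⟩
  have := hR.2.fintype
  let A : {c : Associates R | ∃ a : R, Irreducible a ∧ ¬ Prime a ∧ Associates.mk a = c} → R :=
    fun c => c.2.choose
  have hirr : ∀ i, Irreducible (A i) ∧ ¬ Prime (A i) :=
    fun i => ⟨i.2.choose_spec.1, i.2.choose_spec.2.1⟩
  have hA : ∀ a : R, Irreducible a → ¬ Prime a → ∃ i, Associated a (A i) := by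
    intro b hb hbp
    refine ⟨⟨Associates.mk b, b, hb, hbp, rfl⟩, Associates.mk_eq_mk_iff_associated.1 ?_⟩
    exact (Exists.choose_spec (⟨b, hb, hbp, rfl⟩ : ∃ a : R, Irreducible a ∧ ¬ Prime a ∧
      Associates.mk a = Associates.mk b)).2.2.symm
  let D := Localization (primeProducts R)
  have : IsDomain D := IsLocalization.isDomain_localization primeProducts_le_nonZeroDivisors
  have hnp : ∀ p, Prime p → ¬ p ∣ a := fun p hp h =>
    hap ((hp.irreducible.associated_of_dvd ha h).prime hp)
  rcases exists_dvd_pow_or_isCoprime (A := fun i => algebraMap R D (A i))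
      (fun z hz => by
        simpa only [map_prod, map_pow] using exists_associated_algebraMap_prod hatom hA hz)
      (irreducible_algebraMap_of_not_prime (D := D) hirr hatom hA ha hap)
      (algebraMap R D y) with ⟨n, hn⟩ | hco
  · right
    refine ⟨n, dvd_of_algebraMap_dvd (D := D) hnp ?_⟩
    rwa [map_pow]
  · left
    refine dvd_of_algebraMap_dvd (D := D) hnp (hco.dvd_of_dvd_mul_right ?_)
    rw [← map_mul]
    exact map_dvd _ hxy

end PrimaryAtoms

/-! ### Factorizations into primary atoms -/

section PrimaryFactorization

/-- `DvdPow a b` says that `a` divides a power of `b`. -/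
def DvdPow {R : Type*} [Monoid R] (a b : R) : Prop := ∃ n : ℕ, a ∣ b ^ n

section DvdPow

variable {R : Type*} [CommMonoid R] {a b c x y : R}

theorem DvdPow.refl (a : R) : DvdPow a a := ⟨1, by simp⟩

theorem DvdPow.trans : DvdPow a b → DvdPow b c → DvdPow a c := by
  rintro ⟨n, hn⟩ ⟨m, hm⟩
  exact ⟨m * n, hn.trans (by rw [pow_mul]; exact pow_dvd_pow_of_dvd hm n)⟩

theorem DvdPow.of_dvd (h : a ∣ b) : DvdPow a b := ⟨1, by simpa using h⟩

theorem DvdPow.of_pow {m : ℕ} : DvdPow a (b ^ m) → DvdPow a b :=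
  fun ⟨n, hn⟩ => ⟨m * n, by rwa [pow_mul]⟩

theorem not_dvdPow_of_isUnit (ha : Irreducible a) (hx : IsUnit x) : ¬ DvdPow a x :=
  fun ⟨n, hn⟩ => ha.not_isUnit (isUnit_of_dvd_unit hn (hx.pow n))

end DvdPow

variable {R : Type*} [CommRing R] [IsDomain R]

namespace HasPrimaryAtoms

variable (h : HasPrimaryAtoms R)
include h

omit [IsDomain R] in
theorem induction_on {P : R → Prop} (hunit : ∀ u, IsUnit u → P u)
    (hmul : ∀ a x, Irreducible a → x ≠ 0 → P x → P (a * x)) {x : R} (hx : x ≠ 0) : P x := by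
  by_cases hu : IsUnit x
  · exact hunit x hu
  obtain ⟨s, hs, rfl⟩ := h.exists_factors x hx hu
  clear hu
  induction s using Multiset.induction_on with
  | empty => exact hunit _ (by simp)
  | cons a t ih =>
    rw [Multiset.prod_cons] at hx ⊢
    have ht := right_ne_zero_of_mul hx
    exact hmul a _ (hs a (Multiset.mem_cons_self a t)) ht
      (ih (fun b hb => hs b (Multiset.mem_cons_of_mem hb)) ht)

variable {a b c x y : R}

/-- Among primary atoms, dividing a power of each other is a symmetric relation. -/
theorem dvdPow_symm (ha : Irreducible a) (hb : Irreducible b) : DvdPow a b → DvdPow b a := by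
  rintro ⟨n, hn⟩
  induction n with
  | zero => exact absurd (isUnit_of_dvd_one (by simpa using hn)) ha.not_isUnit
  | succ n ih =>
    obtain ⟨d, hd⟩ := hn
    have h1 : b ∣ d * a := by
      rw [mul_comm, ← hd]
      exact dvd_pow_self b n.succ_ne_zero
    rcases h.dvd_or_dvd_pow hb h1 with ⟨e, rfl⟩ | h2
    · exact ih ⟨e, mul_left_cancel₀ hb.ne_zero (by rw [← pow_succ', hd]; ring)⟩
    · exact h2

omit [IsDomain R] in
theorem dvdPow_mul (ha : Irreducible a) : DvdPow a (x * y) → DvdPow a x ∨ DvdPow a y := by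
  rintro ⟨n, hn⟩
  rw [mul_pow] at hn
  rcases h.dvd_or_dvd_pow ha hn with h1 | ⟨m, hm⟩
  · exact Or.inl ⟨n, h1⟩
  · exact Or.inr ⟨n * m, by rwa [pow_mul]⟩

/-- Factors that are not divisible by `a` up to powers can be cancelled from powers of `a`. -/
theorem pow_dvd_of_pow_dvd_mul (ha : Irreducible a) (hy : ¬ DvdPow a y) (k : ℕ) :
    ∀ {x : R}, a ^ k ∣ x * y → a ^ k ∣ x := by
  induction k with
  | zero => simp
  | succ k ih =>
    intro x hx
    obtain ⟨z, rfl⟩ := (h.dvd_or_dvd_pow ha ((dvd_pow_self a k.succ_ne_zero).trans hx)).resolve_right hy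
    rw [pow_succ'] at hx ⊢
    rw [mul_assoc] at hx
    exact mul_dvd_mul_left a (ih ((mul_dvd_mul_iff_left ha.ne_zero).1 hx))

/-- Every nonzero element splits into a divisor of a power of `a` and an element that is not
divisible by `a` up to powers. -/
theorem exists_eq_mul (ha : Irreducible a) (hx : x ≠ 0) :
    ∃ u v, x = u * v ∧ DvdPow u a ∧ ¬ DvdPow a v := by
  refine h.induction_on (P := fun x => ∃ u v, x = u * v ∧ DvdPow u a ∧ ¬ DvdPow a v)
    (fun u hu => ⟨1, u, (one_mul u).symm, ⟨0, by simp⟩,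
    not_dvdPow_of_isUnit ha hu⟩) (fun b y hb _ ih => ?_) hx
  obtain ⟨u, v, rfl, ⟨n, hu⟩, hv⟩ := ih
  by_cases hab : DvdPow a b
  · obtain ⟨m, hm⟩ := h.dvdPow_symm ha hb hab
    exact ⟨b * u, v, by ring, ⟨m + n, by rw [pow_add]; exact mul_dvd_mul hm hu⟩, hv⟩
  · exact ⟨u, b * v, by ring, ⟨n, hu⟩, fun h' => (h.dvdPow_mul ha h').elim hab hv⟩

theorem finiteMultiplicity (ha : Irreducible a) (hx : x ≠ 0) : FiniteMultiplicity a x := by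
  obtain ⟨u, v, rfl, ⟨n, hu⟩, hv⟩ := h.exists_eq_mul ha hx
  refine ⟨n, fun hn => ?_⟩
  have h1 := (h.pow_dvd_of_pow_dvd_mul ha hv _ hn).trans hu
  have := (pow_dvd_pow_iff ha.ne_zero ha.not_isUnit).1 h1
  omega

/-- Two atoms that divide powers of each other have associated powers, if there are only finitely
many atoms that are not prime. For `bⁿ = aᵏ t` with `a ∤ t`, there are only finitely many
possibilities for `t` up to units, so two of them agree. -/
theorem exists_associated_pow
    (hfin : {c : Associates R | ∃ a : R, Irreducible a ∧ ¬ Prime a ∧ Associates.mk a = c}.Finite)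
    (ha : Irreducible a) (hb : Irreducible b) (hab : DvdPow a b) :
    ∃ m n, 0 < n ∧ Associated (b ^ n) (a ^ m) := by
  classical
  by_cases hbp : Prime b
  · obtain ⟨n, hn⟩ := h.dvdPow_symm ha hb hab
    exact ⟨1, 1, one_pos, by simpa using hb.associated_of_dvd ha (hbp.dvd_of_dvd_pow hn)⟩
  obtain ⟨L, hL⟩ : ∃ L : ℕ, ∀ c ∈ hfin.toFinset, (∃ n, Associates.mk a ∣ c ^ n) →
      Associates.mk a ∣ c ^ L := by
    choose! f hf using fun (c : Associates R) (hc : ∃ n, Associates.mk a ∣ c ^ n) => hc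
    exact ⟨hfin.toFinset.sup f, fun c hc hn => (hf c hn).trans (pow_dvd_pow c (Finset.le_sup hc))⟩
  choose t ht hat using fun n =>
    (h.finiteMultiplicity ha (pow_ne_zero n hb.ne_zero)).exists_eq_pow_mul_and_not_dvd
  set k : ℕ → ℕ := fun n => multiplicity a (b ^ n) with hk
  have hmem : ∀ n, Associates.mk (t n) ∈
      Multiset.prod '' Set.Iic (L • hfin.toFinset.val : Multiset (Associates R)) := by
    intro n
    by_cases hu : IsUnit (t n)
    · exact ⟨0, Multiset.zero_le _, by simpa using (Associates.mk_eq_one.2 hu).symm⟩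
    have ht0 : t n ≠ 0 := fun h0 => hat n (h0 ▸ dvd_zero a)
    obtain ⟨s, hs, hst⟩ := h.exists_factors _ ht0 hu
    refine ⟨s.map Associates.mk, ?_, by rw [Associates.prod_mk, hst]⟩
    rw [Set.mem_Iic, Multiset.le_iff_count]
    intro c
    by_cases hc0 : Multiset.count c (s.map Associates.mk) = 0
    · rw [hc0]
      exact Nat.zero_le _
    have hc : c ∈ s.map Associates.mk := Multiset.count_ne_zero.1 hc0
    obtain ⟨d, hd, hdc⟩ := Multiset.mem_map.1 hc
    have hdt : d ∣ t n := hst ▸ Multiset.dvd_prod hd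
    have hdb : DvdPow d b := ⟨n, hdt.trans (ht n ▸ dvd_mul_left _ _)⟩
    have hdp : ¬ Prime d := fun hp => hbp (by
      obtain ⟨m, hm⟩ := hdb
      exact ((hs d hd).associated_of_dvd hb (hp.dvd_of_dvd_pow hm)).prime hp)
    obtain ⟨m, hm⟩ := hab.trans (h.dvdPow_symm (hs d hd) hb hdb)
    have hcF : c ∈ hfin.toFinset := by
      rw [Set.Finite.mem_toFinset]
      exact ⟨d, hs d hd, hdp, hdc⟩
    have hdL := hL c hcF ⟨m, by rw [← hdc, ← Associates.mk_pow]; exact Associates.mk_dvd_mk.2 hm⟩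
    rw [Multiset.count_nsmul, Multiset.count_eq_one_of_mem hfin.toFinset.nodup hcF, mul_one]
    by_contra hlt
    push Not at hlt
    apply hat n
    rw [← Associates.mk_dvd_mk, ← hst, ← Associates.prod_mk]
    refine hdL.trans ((pow_dvd_pow c hlt.le).trans ?_)
    rw [← Multiset.prod_replicate]
    exact Multiset.prod_dvd_prod_of_le (Multiset.le_count_iff_replicate_le.1 le_rfl)
  obtain ⟨m, n, hmn, heq⟩ := ((Set.finite_Iic _).image _).exists_lt_map_eq_of_forall_mem hmem
  obtain ⟨d, rfl⟩ := Nat.exists_eq_add_of_lt hmn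
  rw [Associates.mk_eq_mk_iff_associated] at heq
  have h1 : Associated (b ^ m * (b ^ (d + 1) * a ^ k m)) (b ^ m * a ^ k (m + d + 1)) := by
    have e1 : b ^ m * (b ^ (d + 1) * a ^ k m) =
        a ^ (k m + k (m + d + 1)) * t (m + d + 1) := by
      have := ht (m + d + 1)
      calc _ = b ^ (m + d + 1) * a ^ k m := by ring
        _ = a ^ k (m + d + 1) * t (m + d + 1) * a ^ k m := by rw [← this]
        _ = _ := by ring
    have e2 : b ^ m * a ^ k (m + d + 1) = a ^ (k m + k (m + d + 1)) * t m := by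
      have := ht m
      calc _ = a ^ k m * t m * a ^ k (m + d + 1) := by rw [← this]
        _ = _ := by ring
    rw [e1, e2]
    exact heq.symm.mul_left _
  have h2 := h1.of_mul_left (Associated.refl _) (pow_ne_zero m hb.ne_zero)
  rcases le_or_gt (k (m + d + 1)) (k m) with hle | hlt
  · exfalso
    have h3 : b * a ^ k (m + d + 1) ∣ 1 * a ^ k (m + d + 1) := by
      rw [one_mul]
      refine dvd_trans (mul_dvd_mul (dvd_pow_self b d.succ_ne_zero) (pow_dvd_pow a hle)) h2.dvd
    exact hb.not_isUnit (isUnit_of_dvd_one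
      ((mul_dvd_mul_iff_right (pow_ne_zero _ ha.ne_zero)).1 h3))
  · obtain ⟨e, he⟩ := Nat.exists_eq_add_of_lt hlt
    refine ⟨e + 1, d + 1, d.succ_pos, ?_⟩
    rw [he, add_assoc, pow_add a, mul_comm] at h2
    exact h2.of_mul_left (Associated.refl _) (pow_ne_zero _ ha.ne_zero)

end HasPrimaryAtoms

/-- `M` is positive, and for any two atoms `a`, `b` such that `a` divides a power of `b`, the power
`bᴹ` is associated to a power of `a`. -/
def IsCommonExponent (R : Type*) [CommRing R] (M : ℕ) : Prop :=
  0 < M ∧ ∀ a b : R, Irreducible a → Irreducible b → DvdPow a b → ∃ k, Associated (b ^ M) (a ^ k)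

theorem IsGeneralizedCohenKaplansky.exists_isCommonExponent
    (hR : IsGeneralizedCohenKaplansky R) : ∃ M, IsCommonExponent R M := by
  classical
  have h := hR.hasPrimaryAtoms
  choose! f hf0 hf using fun (p : Associates R × Associates R)
    (hp : ∃ n, 0 < n ∧ ∃ m, p.2 ^ n = p.1 ^ m) => hp
  set F := hR.2.toFinset with hF
  set g : Associates R × Associates R → ℕ := fun p =>
    if ∃ n, 0 < n ∧ ∃ m, p.2 ^ n = p.1 ^ m then f p else 1 with hg
  refine ⟨∏ p ∈ F ×ˢ F, g p, Finset.prod_pos fun p _ => ?_, fun a b ha hb hab => ?_⟩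
  · by_cases hp : ∃ n, 0 < n ∧ ∃ m, p.2 ^ n = p.1 ^ m
    · simpa only [hg, if_pos hp] using hf0 p hp
    · simp only [hg, if_neg hp, one_pos]
  by_cases hbp : Prime b
  · obtain ⟨n, hn⟩ := h.dvdPow_symm ha hb hab
    exact ⟨_, (hb.associated_of_dvd ha (hbp.dvd_of_dvd_pow hn)).pow_pow⟩
  by_cases hap : Prime a
  · obtain ⟨n, hn⟩ := hab
    exact ⟨_, (ha.associated_of_dvd hb (hap.dvd_of_dvd_pow hn)).symm.pow_pow⟩
  obtain ⟨m, n, hn, hmn⟩ := h.exists_associated_pow hR.2 ha hb hab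
  have hp : ∃ n, 0 < n ∧ ∃ m, Associates.mk b ^ n = Associates.mk a ^ m := by
    refine ⟨n, hn, m, ?_⟩
    rw [← Associates.mk_pow, ← Associates.mk_pow, Associates.mk_eq_mk_iff_associated]
    exact hmn
  have hmem : (Associates.mk a, Associates.mk b) ∈ F ×ˢ F := by
    simp only [hF, Finset.mem_product, Set.Finite.mem_toFinset]
    exact ⟨⟨a, ha, hap, rfl⟩, ⟨b, hb, hbp, rfl⟩⟩
  obtain ⟨q, hq⟩ := Finset.dvd_prod_of_mem g hmem
  rw [hq]
  obtain ⟨m', hm'⟩ := hf (Associates.mk a, Associates.mk b) hp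
  refine ⟨m' * q, ?_⟩
  rw [← Associates.mk_eq_mk_iff_associated, Associates.mk_pow, Associates.mk_pow, pow_mul, pow_mul]
  simp only [hg, if_pos hp]
  rw [hm']

end PrimaryFactorization

/-! ### The order of an element at an atom -/

section RootOrd

/-- The exponent of the atom `c` in `x ^ M`. For a common exponent `M` this is `M` times a
valuation: it is additive in `x`, and the powers `x ^ M` are determined up to units by their
exponents at all atoms. -/
noncomputable def rootOrd {R : Type*} [CommRing R] (M : ℕ) (c x : R) : ℕ := multiplicity c (x ^ M)

variable {R : Type*} [CommRing R] [IsDomain R] {M : ℕ} {c x y : R}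

theorem rootOrd_eq {k : ℕ} {t : R} (hc : Irreducible c) (hx : x ^ M = c ^ k * t)
    (ht : ¬ DvdPow c t) : rootOrd M c x = k := by
  refine multiplicity_eq_of_dvd_of_not_dvd (Dvd.intro t hx.symm) ?_
  rw [hx, pow_succ]
  exact fun h => ht (.of_dvd ((mul_dvd_mul_iff_left (pow_ne_zero k hc.ne_zero)).1 h))

theorem rootOrd_of_associated {k : ℕ} (hc : Irreducible c) (hx : Associated (x ^ M) (c ^ k)) :
    rootOrd M c x = k := by
  obtain ⟨u, hu⟩ := hx.symm
  exact rootOrd_eq hc hu.symm (not_dvdPow_of_isUnit hc u.isUnit)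

theorem rootOrd_self (hc : Irreducible c) : rootOrd M c c = M :=
  rootOrd_of_associated hc (Associated.refl _)

theorem rootOrd_of_not_dvdPow (hc : Irreducible c) (hx : ¬ DvdPow c x) : rootOrd M c x = 0 :=
  rootOrd_eq hc (by rw [pow_zero, one_mul]) fun h' => hx h'.of_pow

namespace HasPrimaryAtoms

variable (h : HasPrimaryAtoms R)
include h

variable (hM : IsCommonExponent R M)
include hM

theorem pow_eq_pow_rootOrd_mul (hc : Irreducible c) (hx : x ≠ 0) :
    ∃ t, x ^ M = c ^ rootOrd M c x * t ∧ ¬ DvdPow c t := by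
  suffices ∃ k t, x ^ M = c ^ k * t ∧ ¬ DvdPow c t by
    obtain ⟨k, t, hk, ht⟩ := this
    exact ⟨t, by rwa [rootOrd_eq hc hk ht], ht⟩
  refine h.induction_on (P := fun x => ∃ k t, x ^ M = c ^ k * t ∧ ¬ DvdPow c t)
    (fun u hu => ⟨0, u ^ M, by ring, not_dvdPow_of_isUnit hc (hu.pow M)⟩) ?_ hx
  rintro a y ha - ⟨k, t, hk, ht⟩
  by_cases hca : DvdPow c a
  · obtain ⟨l, u, hu⟩ := hM.2 c a hc ha hca
    refine ⟨l + k, t * (u⁻¹ : Rˣ), ?_, fun h' => ?_⟩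
    · rw [mul_pow, hk, pow_add, ← hu]
      linear_combination -a ^ M * (c ^ k * t) * u.mul_inv
    · exact (h.dvdPow_mul hc h').elim ht (not_dvdPow_of_isUnit hc (u⁻¹).isUnit)
  · refine ⟨k, a ^ M * t, by rw [mul_pow, hk]; ring, fun h' => ?_⟩
    refine (h.dvdPow_mul hc h').elim (fun h' => hca h'.of_pow) ht

theorem rootOrd_mul (hc : Irreducible c) (hx : x ≠ 0) (hy : y ≠ 0) :
    rootOrd M c (x * y) = rootOrd M c x + rootOrd M c y := by
  obtain ⟨s, hs, hs'⟩ := h.pow_eq_pow_rootOrd_mul hM hc hx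
  obtain ⟨t, ht, ht'⟩ := h.pow_eq_pow_rootOrd_mul hM hc hy
  refine rootOrd_eq hc (t := s * t) ?_ fun h' => (h.dvdPow_mul hc h').elim hs' ht'
  rw [mul_pow, pow_add]
  linear_combination (y ^ M) * hs + c ^ rootOrd M c x * s * ht

theorem rootOrd_pow (hc : Irreducible c) (hx : x ≠ 0) (n : ℕ) :
    rootOrd M c (x ^ n) = n * rootOrd M c x := by
  induction n with
  | zero =>
    rw [pow_zero, zero_mul]
    exact rootOrd_of_not_dvdPow hc (not_dvdPow_of_isUnit hc isUnit_one)
  | succ n ih => rw [pow_succ, h.rootOrd_mul hM hc (pow_ne_zero n hx) hx, ih, Nat.succ_mul]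

theorem rootOrd_le_of_dvd (hc : Irreducible c) (hy : y ≠ 0) (hxy : x ∣ y) :
    rootOrd M c x ≤ rootOrd M c y := by
  obtain ⟨z, rfl⟩ := hxy
  rw [h.rootOrd_mul hM hc (left_ne_zero_of_mul hy) (right_ne_zero_of_mul hy)]
  exact Nat.le_add_right _ _

theorem rootOrd_multiset_prod (hc : Irreducible c) (s : Multiset R) (hs : ∀ a ∈ s, Irreducible a) :
    rootOrd M c s.prod = (s.map (rootOrd M c)).sum := by
  induction s using Multiset.induction_on with
  | empty => exact rootOrd_of_not_dvdPow hc (not_dvdPow_of_isUnit hc isUnit_one)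
  | cons a t ih =>
    have ht : ∀ b ∈ t, Irreducible b := fun b hb => hs b (Multiset.mem_cons_of_mem hb)
    rw [Multiset.prod_cons, Multiset.map_cons, Multiset.sum_cons, ← ih ht]
    exact h.rootOrd_mul hM hc (hs a (Multiset.mem_cons_self a t)).ne_zero
      (Multiset.prod_ne_zero fun h0 => (ht 0 h0).ne_zero rfl)

/-- The orders at the atoms determine divisibility up to powers. -/
theorem pow_dvd_pow_of_rootOrd_le (hx : x ≠ 0) (hy : y ≠ 0)
    (hle : ∀ c : R, Irreducible c → rootOrd M c x ≤ rootOrd M c y) : x ^ M ∣ y ^ M := by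
  classical
  by_cases hu : IsUnit x
  · exact (hu.pow M).dvd
  obtain ⟨s, hs, rfl⟩ := h.exists_factors x hx hu
  clear hu hx
  induction hn : s.card using Nat.strong_induction_on generalizing s with
  | _ n ih =>
  rcases s.empty_or_exists_mem with rfl | ⟨b, hb⟩
  · simp
  -- Split off the atoms that divide a power of `b`; the `M`-th power of their product is a power
  -- of `b` up to a unit.
  have hirr := hs b hb
  have hs0 : ∀ t ≤ s, t.prod ≠ 0 := fun t ht =>
    Multiset.prod_ne_zero fun h0 => (hs 0 (Multiset.mem_of_le ht h0)).ne_zero rfl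
  set s₁ := s.filter (DvdPow b) with hs₁
  set s₂ := s.filter (fun a => ¬ DvdPow b a) with hs₂
  have hle₂ : s₂ ≤ s := Multiset.filter_le _ _
  have hsum : s₁ + s₂ = s := Multiset.filter_add_not _ _
  have hprod : s.prod = s₁.prod * s₂.prod := by rw [← hsum, Multiset.prod_add]
  have hcard : s₂.card < n := by
    rw [← hn, ← hsum, Multiset.card_add]
    have : 0 < s₁.card := Multiset.card_pos_iff_exists_mem.2
      ⟨b, Multiset.mem_filter.2 ⟨hb, DvdPow.refl b⟩⟩
    omega
  obtain ⟨z, hz⟩ := ih _ hcard s₂ (fun a ha => hs a (Multiset.mem_of_le hle₂ ha))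
    (fun c hc => (h.rootOrd_le_of_dvd hM hc (hs0 s le_rfl)
      (Multiset.prod_dvd_prod_of_le hle₂)).trans (hle c hc)) rfl
  have hnd : ¬ DvdPow b s₂.prod := by
    have hall : ∀ a ∈ s₂, ¬ DvdPow b a := fun a ha => (Multiset.mem_filter.1 ha).2
    generalize s₂ = t at hall
    induction t using Multiset.induction_on with
    | empty => exact not_dvdPow_of_isUnit hirr (by simp)
    | cons a t iht =>
      rw [Multiset.prod_cons]
      exact fun h' => (h.dvdPow_mul hirr h').elim (hall a (Multiset.mem_cons_self a t))
        (iht fun c hc => hall c (Multiset.mem_cons_of_mem hc))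
  have hnd' : ¬ DvdPow b (s₂.prod ^ M) := fun h' => hnd h'.of_pow
  obtain ⟨k, hk⟩ : ∃ k, Associated (s₁.prod ^ M) (b ^ k) := by
    have hall : ∀ a ∈ s₁, Irreducible a ∧ DvdPow b a := fun a ha =>
      ⟨hs a (Multiset.mem_filter.1 ha).1, (Multiset.mem_filter.1 ha).2⟩
    generalize s₁ = t at hall
    induction t using Multiset.induction_on with
    | empty => exact ⟨0, by simp⟩
    | cons a t iht =>
      obtain ⟨k, hk⟩ := iht fun c hc => hall c (Multiset.mem_cons_of_mem hc)
      have ha := hall a (Multiset.mem_cons_self a t)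
      obtain ⟨l, hl⟩ := hM.2 b a hirr ha.1 ha.2
      exact ⟨l + k, by rw [Multiset.prod_cons, mul_pow, pow_add]; exact hl.mul_mul hk⟩
  have hk' : b ^ k ∣ y ^ M := by
    have h1 : rootOrd M b s₁.prod = k := rootOrd_of_associated hirr hk
    have h2 := hle b hirr
    rw [hprod, h.rootOrd_mul hM hirr (hs0 s₁ (Multiset.filter_le _ _)) (hs0 s₂ hle₂), h1] at h2
    obtain ⟨t, ht, -⟩ := h.pow_eq_pow_rootOrd_mul hM hirr hy
    rw [ht]
    exact (pow_dvd_pow b (by omega)).trans (dvd_mul_right _ _)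
  rw [hz, mul_comm] at hk'
  rw [hprod, mul_pow, hz, mul_comm]
  exact mul_dvd_mul_left _ (hk.dvd.trans (h.pow_dvd_of_pow_dvd_mul hirr hnd' k hk'))

end HasPrimaryAtoms

end RootOrd

/-! ### Transfer Krull monoids and half-factorial monoids -/

section QuotientGroup

variable {B : Type u} [CommMonoid B] [IsCancelMul B]

omit [IsCancelMul B] in
open Algebra.GrothendieckGroup in
theorem exists_eq_div_of (x : QuotientGroup B) : ∃ y z : B, x = of y / of z := by
  induction x using Localization.induction_on with
  | H p =>
    obtain ⟨y, z⟩ := p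
    refine ⟨y, z, ?_⟩
    rw [Localization.mk_eq_monoidOf_mk', eq_div_iff_mul_eq', mul_comm]
    exact (Localization.monoidOf ⊤).mk'_spec' y z

open Algebra.GrothendieckGroup in
theorem div_mem_imageInQuotient_iff (y z : B) :
    (of y / of z : QuotientGroup B) ∈ imageInQuotient B ↔ z ∣ y := by
  constructor
  · rintro ⟨w, hw⟩
    refine ⟨w, of_injective ?_⟩
    rw [map_mul, hw, mul_div_cancel]
  · rintro ⟨w, rfl⟩
    exact ⟨w, by rw [map_mul, mul_div_cancel_left]⟩

/-- Completely integrally closed monoids are root closed. -/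
theorem IsCompletelyIntegrallyClosed.dvd_of_pow_dvd_pow (hB : IsCompletelyIntegrallyClosed B)
    {y z : B} {m : ℕ} (hm : 0 < m) (h : z ^ m ∣ y ^ m) : z ∣ y := by
  rw [← div_mem_imageInQuotient_iff]
  refine hB _ ⟨Algebra.GrothendieckGroup.of (z ^ m), ⟨_, rfl⟩, fun n _ => ?_⟩
  rw [div_pow, ← mul_div_assoc, ← map_pow, ← map_pow, ← map_mul, div_mem_imageInQuotient_iff]
  -- Write `n = m q + r` with `r < m`: then `z ^ m` absorbs the denominator of `(y / z) ^ r`.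
  have e : n = m * (n / m) + n % m := (Nat.div_add_mod n m).symm
  generalize n / m = q at e
  have hr := Nat.mod_lt n hm
  generalize n % m = r at e hr
  subst e
  rw [pow_add, pow_add, pow_mul, pow_mul, mul_comm ((z ^ m) ^ q),
    mul_comm ((y ^ m) ^ q), ← mul_assoc]
  exact mul_dvd_mul ((pow_dvd_pow z hr.le).trans (dvd_mul_right _ _)) (pow_dvd_pow_of_dvd h q)

/-- If every nonempty subset of a monoid contains an element that divides all its elements, then the
monoid is Krull. -/
theorem isKrull_of_forall_exists_forall_dvd
    (hB : ∀ S : Set B, S.Nonempty → ∃ m ∈ S, ∀ x ∈ S, m ∣ x) : IsKrull B := by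
  constructor
  · rintro x ⟨_, ⟨c, rfl⟩, hc⟩
    obtain ⟨y, z, rfl⟩ := exists_eq_div_of x
    rw [div_mem_imageInQuotient_iff]
    obtain ⟨m, hm, hdvd⟩ := hB {y, z} (Set.insert_nonempty _ _)
    rcases hm with rfl | hm
    · obtain ⟨t, rfl⟩ := hdvd z (by simp)
      have hct : ∀ n, t ^ n ∣ c := by
        intro n
        have h1 := hc (n + 1) n.succ_pos
        have h2 : Algebra.GrothendieckGroup.of m / Algebra.GrothendieckGroup.of (m * t) =
            (Algebra.GrothendieckGroup.of t)⁻¹ := by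
          rw [map_mul, ← div_div, div_self', one_div]
        rw [h2, inv_pow, ← div_eq_mul_inv, ← map_pow, div_mem_imageInQuotient_iff] at h1
        exact (pow_dvd_pow t n.le_succ).trans h1
      -- A divisor-minimal cofactor of a power of `t` in `c` shows that `t` is a unit.
      obtain ⟨d, ⟨n, hn⟩, hmin⟩ := hB {d | ∃ n : ℕ, t ^ n * d = c} ⟨c, 0, by simp⟩
      obtain ⟨e, he⟩ := hct (n + 1)
      obtain ⟨f, hf⟩ := hmin e ⟨n + 1, he.symm⟩
      have h3 : d * 1 = d * (t * f) := by
        rw [← hn, pow_succ, mul_assoc] at he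
        have := mul_left_cancel he
        rw [mul_one]
        nth_rewrite 1 [this]
        rw [hf, mul_left_comm]
      exact (isUnit_iff_exists_inv.2 ⟨f, (mul_left_cancel h3).symm⟩).mul_right_dvd.2 dvd_rfl
    · rw [Set.mem_singleton_iff] at hm
      exact hm ▸ hdvd y (by simp)
  · intro I hI hmono
    by_cases hne : ∃ b n, Algebra.GrothendieckGroup.of b ∈ I n
    · obtain ⟨m, ⟨n, hn⟩, hmin⟩ := hB {b | ∃ n, Algebra.GrothendieckGroup.of b ∈ I n} hne
      refine ⟨n, fun N hN => le_antisymm (fun x hx => ?_) (hmono hN)⟩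
      obtain ⟨b, rfl⟩ := (hI N).1 hx
      obtain ⟨w, rfl⟩ := hmin b ⟨N, hx⟩
      rw [← (hI n).2]
      refine ⟨{Algebra.GrothendieckGroup.of m}, Set.finite_singleton _, by simpa using hn, ?_⟩
      intro z hz
      rw [mul_comm m w, map_mul, mul_assoc, mul_comm (Algebra.GrothendieckGroup.of m)]
      exact mul_mem (MonoidHom.mem_mrange.2 ⟨w, rfl⟩) (hz _ rfl)
    · have hempty : ∀ n, I n = ∅ := fun n => Set.eq_empty_of_forall_notMem fun x hx => by
        obtain ⟨b, rfl⟩ := (hI n).1 hx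
        exact hne ⟨b, n, hx⟩
      exact ⟨0, fun m _ => by rw [hempty, hempty]⟩

end QuotientGroup

/-- Whenever a power of an atom is associated to a power of another atom, the exponents agree. -/
def EqualExponents (H : Type*) [Monoid H] : Prop :=
  ∀ a b : H, Irreducible a → Irreducible b → ∀ m n : ℕ, 0 < m → 0 < n →
    Associated (a ^ m) (b ^ n) → m = n

section Cancel

variable {H : Type u} [CommMonoid H] [IsCancelMul H]

theorem eq_of_associated_pow_pow {a b : H} (ha : ¬ IsUnit a) (hab : Associated a b) {m n : ℕ}
    (h : Associated (a ^ m) (b ^ n)) : m = n := by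
  wlog hle : n ≤ m generalizing a b m n
  · exact (this (mt hab.isUnit_iff.2 ha) hab.symm h.symm (le_of_not_ge hle)).symm
  obtain ⟨k, rfl⟩ := Nat.exists_eq_add_of_le hle
  obtain ⟨u, hu⟩ := h.trans (hab.symm.pow_pow (n := n))
  have h2 : a ^ n * (a ^ k * u) = a ^ n * 1 := by rw [mul_one, ← mul_assoc, ← pow_add, hu]
  have h3 : IsUnit (a ^ k) := isUnit_iff_exists_inv.2 ⟨_, mul_left_cancel h2⟩
  rcases Nat.eq_zero_or_pos k with rfl | hk
  · rfl
  · exact absurd ((isUnit_pow_iff hk.ne').1 h3) ha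

/-- In a root closed monoid, powers of atoms are associated only if the exponents agree: if
`aᵐ` and `bⁿ` are associated with `n ≤ m`, then `aⁿ ∣ bⁿ`, so `a ∣ b`. -/
theorem equalExponents_of_dvd_of_pow_dvd_pow
    (hH : ∀ y z : H, ∀ m : ℕ, 0 < m → z ^ m ∣ y ^ m → z ∣ y) : EqualExponents H := by
  intro a b ha hb m n hm hn hab
  wlog hle : n ≤ m generalizing a b m n
  · exact (this b a hb ha n m hn hm hab.symm (le_of_not_ge hle)).symm
  exact eq_of_associated_pow_pow ha.not_isUnit
    (ha.associated_of_dvd hb (hH b a n hn ((pow_dvd_pow a hle).trans hab.dvd))) hab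

/-- If `aᵐ` and `bⁿ` are associated with `m < n`, then `(a / b)ᵐ` is a nonunit of the monoid, and
its powers absorb the denominators of the lower powers of `a / b`, so that all large powers of
`a / b` belong to the monoid. -/
theorem IsSeminormal.equalExponents (hH : IsSeminormal H) : EqualExponents H := by
  intro a b ha hb m n hm hn hab
  by_contra hne
  wlog hlt : m < n generalizing a b m n
  · exact this b a hb ha n m hn hm hab.symm (Ne.symm hne)
      (lt_of_le_of_ne (not_lt.1 hlt) (Ne.symm hne))
  refine hne (eq_of_associated_pow_pow ha.not_isUnit (hb.associated_of_dvd ha ?_).symm hab)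
  rw [← div_mem_imageInQuotient_iff]
  refine hH _ ⟨m * m, Nat.mul_pos hm hm, fun j hj => ?_⟩
  rw [div_pow, ← map_pow, ← map_pow, div_mem_imageInQuotient_iff]
  have e : j = m * (j / m) + j % m := (Nat.div_add_mod j m).symm
  have hq : m ≤ j / m := (Nat.le_div_iff_mul_le hm).2 hj
  generalize j / m = q at e hq
  have hr := Nat.mod_lt j hm
  generalize j % m = r at e hr
  subst e
  have h1 : b ^ (m * q + r) ∣ (b ^ n) ^ q := by
    rw [← pow_mul]
    refine pow_dvd_pow b ?_
    nlinarith
  rw [pow_add a, pow_mul]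
  exact (h1.trans (pow_dvd_pow_of_dvd hab.symm.dvd q)).trans (dvd_mul_right _ _)

end Cancel

/-- Transfer homomorphisms preserve atoms, and Krull monoids are root closed. -/
theorem IsTransferKrull.equalExponents {H : Type u} [CommMonoid H] (hH : IsTransferKrull H) :
    EqualExponents H := by
  obtain ⟨B, _, θ, hB, hθ⟩ := hH
  have hirr : ∀ a, Irreducible a → Irreducible (θ a) := by
    intro a ha
    refine ⟨fun h => ha.not_isUnit ((hθ.isUnit_iff a).1 h), fun b c hbc => ?_⟩
    obtain ⟨v, w, ε, η, rfl, hv, hw⟩ := hθ.exists_lift a b c hbc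
    refine (ha.isUnit_or_isUnit rfl).imp (fun h => ?_) fun h => ?_
    · have := (hθ.isUnit_iff v).2 h
      rwa [hv, Units.isUnit_mul_units] at this
    · have := (hθ.isUnit_iff w).2 h
      rwa [hw, Units.isUnit_mul_units] at this
  intro a b ha hb m n hm hn hab
  refine equalExponents_of_dvd_of_pow_dvd_pow
    (fun y z m hm h => hB.1.dvd_of_pow_dvd_pow hm h) _ _ (hirr a ha) (hirr b hb) m n hm hn ?_
  rw [← map_pow, ← map_pow]
  exact hab.map θ

section HalfFactorial

variable {H : Type u} [CommMonoid H]

theorem multiset_eq_zero_of_isUnit_prod {s : Multiset H} (hs : ∀ x ∈ s, Irreducible x)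
    (hu : IsUnit s.prod) : s = 0 := by
  by_contra h
  obtain ⟨a, ha⟩ := Multiset.exists_mem_of_ne_zero h
  exact (hs a ha).not_isUnit (isUnit_of_dvd_unit (Multiset.dvd_prod ha) hu)

/-- Units can be absorbed into a factorization, so lengths can be computed up to associates. -/
theorem mem_setOfLengths_iff (a : H) (k : ℕ) : k ∈ setOfLengths a ↔
    ∃ s : Multiset H, (∀ x ∈ s, Irreducible x) ∧ s.card = k ∧ Associated s.prod a := by
  constructor
  · rintro (⟨hu, rfl⟩ | ⟨-, -, s, hs, hk, rfl⟩)
    · exact ⟨0, by simp, rfl, by simpa using (associated_one_iff_isUnit.2 hu).symm⟩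
    · exact ⟨s, hs, hk, Associated.refl _⟩
  · rintro ⟨s, hs, rfl, hsa⟩
    by_cases hu : IsUnit a
    · exact Or.inl ⟨hu, by simp [multiset_eq_zero_of_isUnit_prod hs (hsa.isUnit_iff.2 hu)]⟩
    · refine Or.inr ⟨hu, ?_⟩
      induction s using Multiset.induction_on with
      | empty => exact absurd (hsa.isUnit_iff.1 (by simp)) hu
      | cons b t _ =>
        obtain ⟨u, rfl⟩ := hsa
        refine ⟨by simp, (b * u) ::ₘ t, fun x hx => ?_, by simp, by
          rw [Multiset.prod_cons, Multiset.prod_cons, mul_right_comm]⟩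
        rcases Multiset.mem_cons.1 hx with rfl | hx
        · exact (irreducible_mul_units u).2 (hs b (Multiset.mem_cons_self b t))
        · exact hs x (Multiset.mem_cons_of_mem hx)

theorem isHalfFactorial_iff : IsHalfFactorial H ↔
    (∀ a : H, ∃ s : Multiset H, (∀ x ∈ s, Irreducible x) ∧ Associated s.prod a) ∧
    ∀ s t : Multiset H, (∀ x ∈ s, Irreducible x) → (∀ x ∈ t, Irreducible x) →
      Associated s.prod t.prod → s.card = t.card := by
  constructor
  · rintro ⟨-, h⟩
    refine ⟨fun a => ?_, fun s t hs ht hst => ?_⟩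
    · obtain ⟨k, hk, -⟩ := h a
      obtain ⟨s, hs, -, hsa⟩ := (mem_setOfLengths_iff a k).1 hk
      exact ⟨s, hs, hsa⟩
    · exact (h t.prod).unique ((mem_setOfLengths_iff _ _).2 ⟨s, hs, rfl, hst⟩)
        ((mem_setOfLengths_iff _ _).2 ⟨t, ht, rfl, Associated.refl _⟩)
  · rintro ⟨h1, h2⟩
    refine ⟨fun a ha => ?_, fun a => ?_⟩
    · obtain ⟨s, hs, hsa⟩ := h1 a
      rcases (mem_setOfLengths_iff a s.card).2 ⟨s, hs, rfl, hsa⟩ with h | ⟨-, -, t, ht, -, hta⟩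
      · exact absurd h.1 ha
      · exact ⟨t, ht, hta⟩
    · obtain ⟨s, hs, hsa⟩ := h1 a
      refine ⟨s.card, (mem_setOfLengths_iff _ _).2 ⟨s, hs, rfl, hsa⟩, fun k hk => ?_⟩
      obtain ⟨t, ht, rfl, hta⟩ := (mem_setOfLengths_iff _ _).1 hk
      exact h2 t s ht hs (hta.trans hsa.symm)

/-- The length function of a half-factorial monoid is a transfer homomorphism to `ℕ`, unless the
monoid is a group, when the trivial monoid serves instead. -/
theorem IsHalfFactorial.isTransferKrull (hH : IsHalfFactorial H) : IsTransferKrull H := by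
  by_cases hunit : ∀ a : H, IsUnit a
  · refine ⟨PUnit, inferInstance, 1, isKrull_of_forall_exists_forall_dvd
      fun S ⟨x, hx⟩ => ⟨x, hx, fun y _ => ⟨y, rfl⟩⟩, ⟨fun b => ⟨1, 1, rfl⟩, fun a => ?_, ?_⟩⟩
    · exact ⟨fun _ => hunit a, fun _ => isUnit_of_subsingleton _⟩
    · exact fun a b c _ => ⟨a, 1, 1, 1, (mul_one a).symm, rfl, rfl⟩
  push Not at hunit
  obtain ⟨x, hx⟩ := hunit
  obtain ⟨h1, h2⟩ := isHalfFactorial_iff.1 hH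
  choose f hf hfa using h1
  have hlen : ∀ s : Multiset H, (∀ x ∈ s, Irreducible x) → ∀ a, Associated s.prod a →
      (f a).card = s.card := fun s hs a hsa => h2 _ _ (hf a) hs ((hfa a).trans hsa.symm)
  have hadd : ∀ {s t : Multiset H}, (∀ x ∈ s, Irreducible x) → (∀ x ∈ t, Irreducible x) →
      ∀ x ∈ s + t, Irreducible x := fun hs ht x hx => (Multiset.mem_add.1 hx).elim (hs x) (ht x)
  let θ : H →* ULift.{u} (Multiplicative ℕ) :=
    { toFun := fun a => ⟨Multiplicative.ofAdd (f a).card⟩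
      map_one' := by
        rw [hlen 0 (by simp) 1 (by simp)]
        rfl
      map_mul' := fun a b => by
        rw [hlen (f a + f b) (hadd (hf a) (hf b)) (a * b)
          (by rw [Multiset.prod_add]; exact (hfa a).mul_mul (hfa b)), Multiset.card_add]
        rfl }
  have hθ : ∀ a, θ a = ⟨Multiplicative.ofAdd (f a).card⟩ := fun _ => rfl
  obtain ⟨p, hp⟩ : ∃ p : H, Irreducible p := by
    obtain ⟨p, hp⟩ : ∃ p, p ∈ f x := Multiset.exists_mem_of_ne_zero fun h0 => hx (by
      have := hfa x
      rw [h0, Multiset.prod_zero] at this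
      exact this.isUnit_iff.1 isUnit_one)
    exact ⟨p, hf x p hp⟩
  refine ⟨ULift.{u} (Multiplicative ℕ), inferInstance, θ,
    isKrull_of_forall_exists_forall_dvd fun S hS => ?_, ⟨fun b => ?_, fun a => ?_, ?_⟩⟩
  · obtain ⟨m, hm, hmin⟩ := WellFounded.has_min
      (InvImage.wf (fun b : ULift.{u} (Multiplicative ℕ) => b.down.toAdd) Nat.lt_wfRel.wf) S hS
    refine ⟨m, hm, fun y hy => ⟨⟨Multiplicative.ofAdd (y.down.toAdd - m.down.toAdd)⟩, ?_⟩⟩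
    have hle : m.down.toAdd ≤ y.down.toAdd := not_lt.1 (hmin y hy)
    refine ULift.ext _ _ (Multiplicative.toAdd.injective ?_)
    change y.down.toAdd = m.down.toAdd + (y.down.toAdd - m.down.toAdd)
    omega
  · refine ⟨p ^ b.down.toAdd, 1, ?_⟩
    rw [hθ, hlen (Multiset.replicate b.down.toAdd p)
      (fun y hy => (Multiset.eq_of_mem_replicate hy) ▸ hp) _ (by rw [Multiset.prod_replicate])]
    simp
  · constructor
    · intro h
      obtain ⟨b, hb⟩ := isUnit_iff_exists_inv.1 h
      have h0 : (f a).card + b.down.toAdd = 0 :=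
        congrArg (fun z : ULift.{u} (Multiplicative ℕ) => z.down.toAdd) hb
      have h3 : f a = 0 := Multiset.card_eq_zero.1 (by omega)
      have := hfa a
      rw [h3, Multiset.prod_zero] at this
      exact this.isUnit_iff.1 isUnit_one
    · exact fun h => h.map θ
  · intro a b c hbc
    have hcard : (f a).card = b.down.toAdd + c.down.toAdd :=
      congrArg (fun z : ULift.{u} (Multiplicative ℕ) => z.down.toAdd) hbc
    obtain ⟨s, hs⟩ : ∃ s, s ∈ Multiset.powersetCard b.down.toAdd (f a) := by
      rw [← Multiset.card_pos_iff_exists_mem, Multiset.card_powersetCard]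
      exact Nat.choose_pos (by omega)
    obtain ⟨hs, hsb⟩ := Multiset.mem_powersetCard.1 hs
    obtain ⟨t, ht⟩ := Multiset.le_iff_exists_add.1 hs
    obtain ⟨u, hu⟩ := hfa a
    have hsf : ∀ x ∈ s, Irreducible x := fun x hx => hf a x (Multiset.mem_of_le hs hx)
    have htf : ∀ x ∈ t, Irreducible x := fun x hx =>
      hf a x (ht ▸ Multiset.mem_add.2 (Or.inr hx))
    have htc : t.card = c.down.toAdd := by
      rw [ht, Multiset.card_add] at hcard
      omega
    refine ⟨s.prod, t.prod * u, 1, 1, ?_, ?_, ?_⟩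
    · rw [← mul_assoc, ← Multiset.prod_add, ← ht, hu]
    · rw [hθ, hlen s hsf _ (Associated.refl _), hsb]
      simp
    · rw [hθ, hlen t htf _ ⟨u, rfl⟩, htc]
      simp

end HalfFactorial

/-! ### Factorizations in localizations -/

section Localization

variable {R : Type*} [CommRing R] [IsDomain R]

theorem equalExponents_nonZeroDivisors_iff : EqualExponents R⁰ ↔ EqualExponents R := by
  constructor
  · intro h a b ha hb m n hm hn hab
    refine h ⟨a, mem_nonZeroDivisors_of_ne_zero ha.ne_zero⟩
      ⟨b, mem_nonZeroDivisors_of_ne_zero hb.ne_zero⟩ ((irreducible_nonZeroDivisors_iff _).2 ha)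
      ((irreducible_nonZeroDivisors_iff _).2 hb) m n hm hn
      ((associated_nonZeroDivisors_iff _ _).2 hab)
  · intro h a b ha hb m n hm hn hab
    exact h a b ((irreducible_nonZeroDivisors_iff _).1 ha) ((irreducible_nonZeroDivisors_iff _).1 hb)
      m n hm hn ((associated_nonZeroDivisors_iff _ _).1 hab)

namespace HasPrimaryAtoms

variable (h : HasPrimaryAtoms R)
include h

/-- If powers of atoms are associated only with equal exponents, then the order at an atom `c`
counts the atoms of a factorization that are divisible by `c` up to powers. -/
theorem rootOrd_multiset_prod_eq_mul_countP {M : ℕ} (hM : IsCommonExponent R M)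
    (hE : EqualExponents R) {c : R} (hc : Irreducible c) [DecidablePred (DvdPow c)]
    (s : Multiset R) (hs : ∀ a ∈ s, Irreducible a) :
    rootOrd M c s.prod = M * s.countP (DvdPow c) := by
  rw [h.rootOrd_multiset_prod hM hc s hs]
  induction s using Multiset.induction_on with
  | empty => simp
  | cons a t ih =>
    rw [Multiset.map_cons, Multiset.sum_cons, ih fun b hb => hs b (Multiset.mem_cons_of_mem hb)]
    have ha := hs a (Multiset.mem_cons_self a t)
    by_cases hca : DvdPow c a
    · obtain ⟨k, hk⟩ := hM.2 c a hc ha hca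
      have hk0 : 0 < k := by
        rcases Nat.eq_zero_or_pos k with rfl | h0
        · rw [pow_zero] at hk
          exact absurd ((isUnit_pow_iff hM.1.ne').1 (associated_one_iff_isUnit.1 hk)) ha.not_isUnit
        · exact h0
      have hMk : M = k := hE a c ha hc M k hM.1 hk0 hk
      rw [rootOrd_of_associated hc hk, ← hMk, Multiset.countP_cons_of_pos _ hca]
      ring
    · rw [rootOrd_of_not_dvdPow hc hca, Multiset.countP_cons_of_neg _ hca, zero_add]

variable {W : Submonoid R} (hW : ∀ x y : R, x * y ∈ W → x ∈ W)

omit h [IsDomain R] in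
theorem mem_of_isUnit_of_saturated (hW : ∀ x y : R, x * y ∈ W → x ∈ W) {u : R} (hu : IsUnit u) :
    u ∈ W := by
  obtain ⟨v, hv⟩ := isUnit_iff_exists_inv.1 hu
  exact hW u v (hv ▸ one_mem W)

omit h [IsDomain R] in
theorem not_dvdPow_of_mem (hW : ∀ x y : R, x * y ∈ W → x ∈ W) {c u : R} (hc : c ∉ W)
    (hu : u ∈ W) : ¬ DvdPow c u := fun ⟨n, z, hz⟩ => hc (hW c z (hz ▸ pow_mem hu n))

include hW

/-- Atoms outside a saturated multiplicative set `W` are equally many in any two factorizations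
that differ by factors from `W`. The order at an atom outside `W` counts the atoms of its class in
a factorization, where the class of `a` is the set of elements that divide a power of `a`. -/
theorem card_eq_card_of_mul_eq_mul {M : ℕ} (hM : IsCommonExponent R M) (hE : EqualExponents R)
    {s t : Multiset R} (hs : ∀ a ∈ s, Irreducible a ∧ a ∉ W) (ht : ∀ a ∈ t, Irreducible a ∧ a ∉ W)
    {u v : R} (hu : u ∈ W) (hv : v ∈ W) (h0 : 0 ∉ W) (hst : s.prod * u = t.prod * v) :
    s.card = t.card := by
  classical
  have hord : ∀ c, Irreducible c → c ∉ W → s.countP (DvdPow c) = t.countP (DvdPow c) := by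
    intro c hc hcW
    have key : ∀ s : Multiset R, (∀ a ∈ s, Irreducible a ∧ a ∉ W) → ∀ u ∈ W,
        rootOrd M c (s.prod * u) = M * s.countP (DvdPow c) := by
      intro s hs u hu
      rw [h.rootOrd_mul hM hc (Multiset.prod_ne_zero fun h' => (hs 0 h').1.ne_zero rfl)
        (fun h' => h0 (h' ▸ hu)), rootOrd_of_not_dvdPow hc (not_dvdPow_of_mem hW hcW hu), add_zero,
        h.rootOrd_multiset_prod_eq_mul_countP hM hE hc s fun a ha => (hs a ha).1]
    have := key s hs u hu
    rw [hst, key t ht v hv] at this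
    exact (Nat.eq_of_mul_eq_mul_left hM.1 this).symm
  let cls : R → Set R := fun a => {c | DvdPow c a}
  have hcls : ∀ a c, Irreducible a → Irreducible c → (cls c = cls a ↔ DvdPow c a) := by
    intro a c ha hc
    refine ⟨fun he => (he.subset (DvdPow.refl c) : c ∈ cls a), fun hd => Set.ext fun x =>
      ⟨fun hx => DvdPow.trans hx hd, fun hx => DvdPow.trans hx (h.dvdPow_symm hc ha hd)⟩⟩
  have hmap : s.map cls = t.map cls := by
    ext X
    rw [Multiset.count_map, Multiset.count_map]
    by_cases hX : ∃ c, Irreducible c ∧ c ∉ W ∧ cls c = X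
    · obtain ⟨c, hc, hcW, rfl⟩ := hX
      have key : ∀ s : Multiset R, (∀ a ∈ s, Irreducible a ∧ a ∉ W) →
          (s.filter fun a => cls c = cls a).card = s.countP (DvdPow c) := by
        intro s hs
        rw [Multiset.countP_eq_card_filter]
        congr 1
        exact Multiset.filter_congr fun a ha => hcls a c (hs a ha).1 hc
      rw [key s hs, key t ht, hord c hc hcW]
    · have key : ∀ s : Multiset R, (∀ a ∈ s, Irreducible a ∧ a ∉ W) →
          (s.filter fun a => X = cls a) = 0 := by
        intro s hs
        rw [Multiset.filter_eq_nil]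
        rintro a ha rfl
        exact hX ⟨a, (hs a ha).1, (hs a ha).2, rfl⟩
      rw [key s hs, key t ht]
  simpa using congrArg Multiset.card hmap

omit [IsDomain R] in
theorem exists_irreducible_dvd_of_notMem {x : R} (hx : x ≠ 0) (hxW : x ∉ W) :
    ∃ b, Irreducible b ∧ b ∉ W ∧ b ∣ x := by
  refine h.induction_on (P := fun x => x ∉ W → ∃ b, Irreducible b ∧ b ∉ W ∧ b ∣ x)
    (fun u hu huW => absurd (mem_of_isUnit_of_saturated hW hu) huW) (fun a x ha _ ih hax => ?_)
    hx hxW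
  by_cases haW : a ∈ W
  · obtain ⟨b, hb, hbW, hbx⟩ := ih fun hx => hax (mul_mem haW hx)
    exact ⟨b, hb, hbW, hbx.mul_left a⟩
  · exact ⟨a, ha, haW, dvd_mul_right a x⟩

variable {L : Type*} [CommRing L] [Algebra R L] [IsLocalization W L]

omit h [IsDomain R] in
theorem isUnit_algebraMap_iff_of_saturated {x : R} : IsUnit (algebraMap R L x) ↔ x ∈ W := by
  refine ⟨fun hx => ?_, fun hx => IsLocalization.map_units L ⟨x, hx⟩⟩
  obtain ⟨m, hm, y, rfl⟩ := (IsLocalization.algebraMap_isUnit_iff W).1 hx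
  exact hW x y hm

omit [IsDomain R] hW in
theorem exists_multiset_associated {β : L} (hβ : β ≠ 0) :
    ∃ s : Multiset R, (∀ a ∈ s, Irreducible a ∧ a ∉ W) ∧
      Associated (algebraMap R L s.prod) β := by
  obtain ⟨x, s, rfl⟩ := IsLocalization.exists_mk'_eq W β
  have hx : x ≠ 0 := by
    rintro rfl
    exact hβ (IsLocalization.mk'_zero s)
  suffices ∃ s : Multiset R, (∀ a ∈ s, Irreducible a ∧ a ∉ W) ∧
      Associated (algebraMap R L s.prod) (algebraMap R L x) by
    obtain ⟨t, ht, htx⟩ := this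
    refine ⟨t, ht, htx.trans ?_⟩
    rw [← IsLocalization.mk'_spec L x s]
    exact associated_mul_unit_left _ _ (IsLocalization.map_units L s)
  refine h.induction_on (P := fun x => ∃ s : Multiset R, (∀ a ∈ s, Irreducible a ∧ a ∉ W) ∧
    Associated (algebraMap R L s.prod) (algebraMap R L x)) (fun u hu => ⟨0, by simp, ?_⟩) ?_ hx
  · rw [Multiset.prod_zero, map_one]
    exact (associated_one_iff_isUnit.2 (hu.map _)).symm
  · rintro a y ha - ⟨t, ht, hty⟩
    rw [map_mul]
    by_cases haW : a ∈ W
    · exact ⟨t, ht, hty.trans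
        (associated_unit_mul_right _ _ (IsLocalization.map_units L ⟨a, haW⟩))⟩
    · refine ⟨a ::ₘ t, fun b hb => ?_, ?_⟩
      · rcases Multiset.mem_cons.1 hb with rfl | hb
        exacts [⟨ha, haW⟩, ht b hb]
      · rw [Multiset.prod_cons, map_mul]
        exact hty.mul_left _

variable (h0 : (0 : R) ∉ W)
include h0

/-- Localization keeps atoms irreducible, unless it makes them units. If `a s = x y` with `s ∈ W`
and `x` and `y` have atoms `b` and `c` outside of `W`, then `b ∣ a`, so that `c ∣ s`. -/
theorem irreducible_algebraMap_of_notMem {a : R} (ha : Irreducible a) (haW : a ∉ W) :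
    Irreducible (algebraMap R L a) := by
  have hW0 : W ≤ R⁰ := fun x hx => mem_nonZeroDivisors_of_ne_zero fun h' => h0 (h' ▸ hx)
  refine ⟨fun hu => haW ((isUnit_algebraMap_iff_of_saturated hW).1 hu), fun β γ hβγ => ?_⟩
  obtain ⟨x, s, rfl⟩ := IsLocalization.exists_mk'_eq W β
  obtain ⟨y, t, rfl⟩ := IsLocalization.exists_mk'_eq W γ
  by_contra! hcon
  have hunit : ∀ (x : R) (s : W), ¬ IsUnit (IsLocalization.mk' L x s) → x ∉ W := by
    intro x s hn hx
    refine hn (isUnit_of_mul_isUnit_left (y := algebraMap R L s) ?_)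
    rw [IsLocalization.mk'_spec]
    exact IsLocalization.map_units L ⟨x, hx⟩
  have hx := hunit x s hcon.1
  have hy := hunit y t hcon.2
  have heq : a * (s * t) = x * y := by
    apply IsLocalization.injective L hW0
    rw [map_mul, hβγ, ← IsLocalization.mk'_mul, map_mul (algebraMap R L) (s : R)]
    have := IsLocalization.mk'_spec L (x * y) (s * t)
    rwa [Submonoid.coe_mul, map_mul (algebraMap R L) (s : R)] at this
  have hst : (s * t : R) ∈ W := mul_mem s.2 t.2
  have hne : x * y ≠ 0 := heq ▸ mul_ne_zero ha.ne_zero fun h' => h0 (h' ▸ hst)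
  obtain ⟨b, hb, hbW, z, rfl⟩ :=
    h.exists_irreducible_dvd_of_notMem hW (left_ne_zero_of_mul hne) hx
  obtain ⟨c, hc, hcW, w, rfl⟩ :=
    h.exists_irreducible_dvd_of_notMem hW (right_ne_zero_of_mul hne) hy
  have h1 : b ∣ a := (h.dvd_or_dvd_pow hb (x := a) (y := s * t)
    ⟨z * (c * w), by rw [heq]; ring⟩).resolve_right (not_dvdPow_of_mem hW hbW hst)
  obtain ⟨u, rfl⟩ := hb.associated_of_dvd ha h1
  have h2 : (u : R) * (s * t) = c * (z * w) :=
    mul_left_cancel₀ hb.ne_zero (by rw [← mul_assoc, heq]; ring)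
  have h3 : c ∣ s * t := (u.isUnit.dvd_mul_left).1 ⟨z * w, h2⟩
  exact not_dvdPow_of_mem hW hcW hst (.of_dvd h3)

theorem equalExponents_of_localization (hL : EqualExponents L) {a b : R} (ha : Irreducible a)
    (hb : Irreducible b) (haW : a ∉ W) (hbW : b ∉ W) {m n : ℕ} (hm : 0 < m) (hn : 0 < n)
    (hab : Associated (a ^ m) (b ^ n)) : m = n := by
  refine hL _ _ (h.irreducible_algebraMap_of_notMem hW h0 ha haW)
    (h.irreducible_algebraMap_of_notMem hW h0 hb hbW) m n hm hn ?_
  rw [← map_pow, ← map_pow]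
  exact hab.map (algebraMap R L)

theorem exists_irreducible_associated {β : L} (hβ : Irreducible β) (hβ0 : β ≠ 0) :
    ∃ a : R, Irreducible a ∧ a ∉ W ∧ Associated (algebraMap R L a) β := by
  obtain ⟨s, hs, hsβ⟩ := h.exists_multiset_associated (W := W) hβ0
  rcases s.empty_or_exists_mem with rfl | ⟨a, ha⟩
  · rw [Multiset.prod_zero, map_one] at hsβ
    exact absurd (hsβ.isUnit_iff.1 isUnit_one) hβ.not_isUnit
  · obtain ⟨ha1, ha2⟩ := hs a ha
    refine ⟨a, ha1, ha2, (h.irreducible_algebraMap_of_notMem hW h0 ha1 ha2).associated_of_dvd hβ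
      ((map_dvd _ (Multiset.dvd_prod ha)).trans hsβ.dvd)⟩

/-- If powers of atoms are associated only with equal exponents, then every localization at a
saturated multiplicative set is half-factorial. -/
theorem isHalfFactorial_of_equalExponents {M : ℕ} (hM : IsCommonExponent R M)
    (hE : EqualExponents R) [IsDomain L] : IsHalfFactorial L⁰ := by
  have hW0 : W ≤ R⁰ := fun x hx => mem_nonZeroDivisors_of_ne_zero fun h' => h0 (h' ▸ hx)
  rw [isHalfFactorial_iff]
  constructor
  · intro β
    obtain ⟨s, hs, hsβ⟩ := h.exists_multiset_associated (W := W) (nonZeroDivisors.coe_ne_zero β)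
    obtain ⟨t, ht, htirr⟩ := exists_multiset_nonZeroDivisors (s.map (algebraMap R L)) fun x hx => by
      obtain ⟨a, ha, rfl⟩ := Multiset.mem_map.1 hx
      exact h.irreducible_algebraMap_of_notMem hW h0 (hs a ha).1 (hs a ha).2
    refine ⟨t, htirr, (associated_nonZeroDivisors_iff _ _).2 ?_⟩
    rw [map_multiset_prod, ← ht] at hsβ
    have e : ((t.prod : L⁰) : L) = (t.map (↑)).prod := map_multiset_prod (Submonoid.subtype L⁰) t
    rwa [e]
  · have hlift : ∀ s : Multiset L⁰, (∀ x ∈ s, Irreducible x) → ∃ t : Multiset R,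
        (∀ a ∈ t, Irreducible a ∧ a ∉ W) ∧ t.card = s.card ∧
          Associated (algebraMap R L t.prod) (s.prod : L⁰) := by
      intro s hs
      induction s using Multiset.induction_on with
      | empty => exact ⟨0, by simp, by simp, by simp⟩
      | cons β s ih =>
        obtain ⟨t, ht, htc, hts⟩ := ih fun x hx => hs x (Multiset.mem_cons_of_mem hx)
        obtain ⟨a, ha, haW, haβ⟩ := h.exists_irreducible_associated hW h0
          ((irreducible_nonZeroDivisors_iff β).1 (hs β (Multiset.mem_cons_self β s)))
          (nonZeroDivisors.coe_ne_zero β)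
        refine ⟨a ::ₘ t, fun b hb => ?_, by simp [htc], ?_⟩
        · rcases Multiset.mem_cons.1 hb with rfl | hb
          exacts [⟨ha, haW⟩, ht b hb]
        · rw [Multiset.prod_cons, Multiset.prod_cons, map_mul, Submonoid.coe_mul]
          exact haβ.mul_mul hts
    intro s t hs ht hst
    obtain ⟨s', hs', hsc, hss⟩ := hlift s hs
    obtain ⟨t', ht', htc, htt⟩ := hlift t ht
    rw [← hsc, ← htc]
    obtain ⟨ε, hε⟩ := (hss.trans ((associated_nonZeroDivisors_iff _ _).1 hst)).trans htt.symm
    obtain ⟨⟨x, w⟩, hxw⟩ := IsLocalization.surj W (ε : L)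
    have hxW : x ∈ W := by
      rw [← isUnit_algebraMap_iff_of_saturated (L := L) hW, ← hxw]
      exact ε.isUnit.mul (IsLocalization.map_units L w)
    refine h.card_eq_card_of_mul_eq_mul hW hM hE hs' ht' hxW w.2 h0 ?_
    apply IsLocalization.injective L hW0
    rw [map_mul, map_mul, ← hε, ← hxw]
    ring

end HasPrimaryAtoms

end Localization

/-! ### Atoms of the integral closure -/

section IntegralClosure

variable {R : Type*} [CommRing R] [IsDomain R] {K : Type*} [Field K] [Algebra R K]

omit [IsDomain R] in
/-- The integral closure is root closed. -/
theorem equalExponents_integralClosure : EqualExponents (integralClosure R K) := by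
  rw [← equalExponents_nonZeroDivisors_iff]
  refine equalExponents_of_dvd_of_pow_dvd_pow fun y z m hm => ?_
  rintro ⟨w, hw⟩
  have hz : ((z : integralClosure R K) : K) ≠ 0 := by simp
  have hw' : (((y : integralClosure R K) : K) / ((z : integralClosure R K) : K)) ^ m =
      ((w : integralClosure R K) : K) := by
    have := congrArg (fun x : (integralClosure R K)⁰ => ((x : integralClosure R K) : K)) hw
    simp only [SubmonoidClass.coe_pow, MulMemClass.coe_mul] at this
    rw [div_pow, this, mul_div_cancel_left₀ _ (pow_ne_zero m hz)]
  have hint : IsIntegral R (((y : integralClosure R K) : K) / ((z : integralClosure R K) : K)) :=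
    IsIntegral.of_pow hm (hw' ▸ (w : integralClosure R K).2)
  rw [dvd_nonZeroDivisors_iff]
  exact ⟨⟨_, hint⟩, Subtype.ext (mul_div_cancel₀ _ hz).symm⟩

omit [IsDomain R] in
theorem equalExponents_of_image_subset
    (h6 : algebraMap R (integralClosure R K) '' {a : R | Irreducible a} ⊆
      {x : integralClosure R K | Irreducible x}) : EqualExponents R := by
  intro a b ha hb m n hm hn hab
  refine equalExponents_integralClosure (K := K) (algebraMap R _ a) (algebraMap R _ b)
    (h6 ⟨a, ha, rfl⟩) (h6 ⟨b, hb, rfl⟩) m n hm hn ?_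
  rw [← map_pow, ← map_pow]
  exact hab.map _

variable [IsFractionRing R K]

theorem exists_eq_div_of_ne_zero {x : K} (hx : x ≠ 0) :
    ∃ w u : R, w ≠ 0 ∧ u ≠ 0 ∧ x = algebraMap R K w / algebraMap R K u := by
  obtain ⟨w, u, hu, rfl⟩ := IsFractionRing.div_surjective (A := R) x
  refine ⟨w, u, ?_, nonZeroDivisors.ne_zero hu, rfl⟩
  rintro rfl
  simp at hx

namespace HasPrimaryAtoms

variable (h : HasPrimaryAtoms R) {M : ℕ} (hM : IsCommonExponent R M)
include h hM

/-- A fraction is integral over `R` if and only if its orders at all atoms are nonnegative, since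
integral elements are almost integral, and elements with nonnegative orders have a power
in `R`. -/
theorem isIntegral_div_iff {w u : R} (hw : w ≠ 0) (hu : u ≠ 0) :
    IsIntegral R (algebraMap R K w / algebraMap R K u) ↔
      ∀ c : R, Irreducible c → rootOrd M c u ≤ rootOrd M c w := by
  have hu' : algebraMap R K u ≠ 0 := by simpa using hu
  constructor
  · intro hint c hc
    obtain ⟨d, hd, hdn⟩ := hint.isAlmostIntegral
    have hd0 := nonZeroDivisors.ne_zero hd
    have key : ∀ n, n * rootOrd M c u ≤ rootOrd M c d + n * rootOrd M c w := by
      intro n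
      obtain ⟨r, hr⟩ := hdn n
      rw [← h.rootOrd_pow hM hc hu, ← h.rootOrd_pow hM hc hw,
        ← h.rootOrd_mul hM hc hd0 (pow_ne_zero n hw)]
      refine h.rootOrd_le_of_dvd hM hc (mul_ne_zero hd0 (pow_ne_zero n hw)) ⟨r, ?_⟩
      apply IsFractionRing.injective R K
      rw [map_mul, map_mul, hr, map_pow, map_pow, Algebra.smul_def, div_pow]
      field_simp
    by_contra! hlt
    have := key (rootOrd M c d + 1)
    nlinarith
  · intro hle
    obtain ⟨z, hz⟩ := h.pow_dvd_pow_of_rootOrd_le hM hu hw hle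
    refine IsIntegral.of_pow hM.1 ?_
    rw [div_pow, ← map_pow, hz, map_mul, map_pow, mul_div_cancel_left₀ _ (pow_ne_zero M hu')]
    exact isIntegral_algebraMap

/-- An integral fraction whose orders are all zero is a unit of the integral closure. -/
theorem isUnit_of_rootOrd_eq {w u : R} (hw : w ≠ 0) (hu : u ≠ 0) {x : integralClosure R K}
    (hx : (x : K) = algebraMap R K w / algebraMap R K u)
    (heq : ∀ c : R, Irreducible c → rootOrd M c u = rootOrd M c w) : IsUnit x := by
  have hw' : algebraMap R K w ≠ 0 := by simpa using hw
  have hu' : algebraMap R K u ≠ 0 := by simpa using hu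
  have hint := (h.isIntegral_div_iff hM (K := K) hu hw).2 fun c hc => (heq c hc).ge
  refine isUnit_iff_exists_inv.2 ⟨⟨_, hint⟩, Subtype.ext ?_⟩
  rw [MulMemClass.coe_mul, hx]
  simp only [OneMemClass.coe_one]
  field_simp

theorem not_isUnit_algebraMap {a : R} (ha : Irreducible a) :
    ¬ IsUnit (algebraMap R (integralClosure R K) a) := by
  intro hu
  obtain ⟨y, hy⟩ := isUnit_iff_exists_inv.1 hu
  have ha' : algebraMap R K a ≠ 0 := by simpa using ha.ne_zero
  have hy' : (y : K) = algebraMap R K 1 / algebraMap R K a := by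
    rw [map_one, eq_div_iff ha', mul_comm]
    exact congrArg Subtype.val hy
  have hle := (h.isIntegral_div_iff hM one_ne_zero ha.ne_zero).1 (hy' ▸ y.2) a ha
  rw [rootOrd_self ha, rootOrd_of_not_dvdPow ha (not_dvdPow_of_isUnit ha isUnit_one)] at hle
  exact absurd hM.1 (by omega)

variable (hE : EqualExponents R)
include hE

/-- If powers of atoms are associated only with equal exponents, then all orders are multiples of
the common exponent, and they depend only on the class of the atom. -/
theorem dvd_rootOrd {c x : R} (hc : Irreducible c) (hx : x ≠ 0) :
    M ∣ rootOrd M c x ∧ ∀ d, Irreducible d → DvdPow c d → rootOrd M d x = rootOrd M c x := by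
  classical
  by_cases hu : IsUnit x
  · rw [rootOrd_of_not_dvdPow hc (not_dvdPow_of_isUnit hc hu)]
    exact ⟨dvd_zero M, fun d hd _ => rootOrd_of_not_dvdPow hd (not_dvdPow_of_isUnit hd hu)⟩
  obtain ⟨s, hs, rfl⟩ := h.exists_factors x hx hu
  rw [h.rootOrd_multiset_prod_eq_mul_countP hM hE hc s hs]
  refine ⟨dvd_mul_right _ _, fun d hd hcd => ?_⟩
  rw [h.rootOrd_multiset_prod_eq_mul_countP hM hE hd s hs]
  congr 1
  refine Multiset.countP_congr rfl fun a _ => propext ?_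
  exact ⟨fun hda => hcd.trans hda, fun hca => (h.dvdPow_symm hc hd hcd).trans hca⟩

/-- The order of an atom `a` of `R` is the common exponent at the class of `a` and zero elsewhere,
and all orders are multiples of the common exponent, so in a factorization of `a` one factor has
all orders zero. -/
theorem irreducible_algebraMap_integralClosure {a : R} (ha : Irreducible a) :
    Irreducible (algebraMap R (integralClosure R K) a) := by
  refine ⟨h.not_isUnit_algebraMap hM ha, fun x y hxy => ?_⟩
  have hxy' : algebraMap R K a = x * y := congrArg Subtype.val hxy
  have hne : (x * y : K) ≠ 0 := by
    rw [← hxy']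
    simpa using ha.ne_zero
  obtain ⟨w, u, hw, hu, hx⟩ := exists_eq_div_of_ne_zero (R := R) (left_ne_zero_of_mul hne)
  obtain ⟨w', u', hw', hu', hy⟩ := exists_eq_div_of_ne_zero (R := R) (right_ne_zero_of_mul hne)
  have hx1 := (h.isIntegral_div_iff hM hw hu).1 (hx ▸ x.2)
  have hy1 := (h.isIntegral_div_iff hM hw' hu').1 (hy ▸ y.2)
  have heq : a * (u * u') = w * w' := by
    apply IsFractionRing.injective R K
    have h1 : algebraMap R K u ≠ 0 := by simpa using hu
    have h2 : algebraMap R K u' ≠ 0 := by simpa using hu'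
    rw [hx, hy] at hxy'
    rw [map_mul, map_mul, map_mul, hxy']
    field_simp
  have hord : ∀ c, Irreducible c → rootOrd M c a + (rootOrd M c u + rootOrd M c u') =
      rootOrd M c w + rootOrd M c w' := by
    intro c hc
    rw [← h.rootOrd_mul hM hc hu hu', ← h.rootOrd_mul hM hc ha.ne_zero (mul_ne_zero hu hu'), heq,
      h.rootOrd_mul hM hc hw hw']
  -- The orders at atoms outside the class of `a` vanish in any case.
  have hunit : ∀ {x : integralClosure R K} {w u : R}, w ≠ 0 → u ≠ 0 →
      (x : K) = algebraMap R K w / algebraMap R K u →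
      (∀ c, Irreducible c → ¬ DvdPow c a → rootOrd M c u = rootOrd M c w) →
      rootOrd M a u = rootOrd M a w → IsUnit x := by
    intro x w u hw hu hx hc hau
    refine h.isUnit_of_rootOrd_eq hM hw hu hx fun c hcirr => ?_
    by_cases hca : DvdPow c a
    · have hac := h.dvdPow_symm hcirr ha hca
      rw [(h.dvd_rootOrd hM hE ha hw).2 c hcirr hac, (h.dvd_rootOrd hM hE ha hu).2 c hcirr hac, hau]
    · exact hc c hcirr hca
  have hout : ∀ c, Irreducible c → ¬ DvdPow c a →
      rootOrd M c u = rootOrd M c w ∧ rootOrd M c u' = rootOrd M c w' := by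
    intro c hc hca
    have h1 := hord c hc
    rw [rootOrd_of_not_dvdPow hc hca] at h1
    have := hx1 c hc
    have := hy1 c hc
    omega
  have hMa : M = (rootOrd M a w - rootOrd M a u) + (rootOrd M a w' - rootOrd M a u') := by
    have h1 := hord a ha
    rw [rootOrd_self ha] at h1
    have := hx1 a ha
    have := hy1 a ha
    omega
  have hd1 : M ∣ rootOrd M a w - rootOrd M a u :=
    Nat.dvd_sub (h.dvd_rootOrd hM hE ha hw).1 (h.dvd_rootOrd hM hE ha hu).1
  rcases Nat.eq_zero_or_pos (rootOrd M a w - rootOrd M a u) with h0 | hpos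
  · left
    refine hunit hw hu hx (fun c hc hca => (hout c hc hca).1) ?_
    have := hx1 a ha
    omega
  · right
    refine hunit hw' hu' hy (fun c hc hca => (hout c hc hca).2) ?_
    have := hy1 a ha
    have := Nat.le_of_dvd hpos hd1
    omega

/-- Every atom of the integral closure has positive order, hence order at least the common
exponent, at some atom `c` of `R`, and then `c` divides it in the integral closure. -/
theorem exists_eq_algebraMap_mul_unit {x : integralClosure R K} (hx : Irreducible x) :
    ∃ (a : R) (ε : (integralClosure R K)ˣ), Irreducible a ∧
      x = algebraMap R (integralClosure R K) a * ε := by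
  have hx0 : (x : K) ≠ 0 := by simpa using hx.ne_zero
  obtain ⟨w, u, hw, hu, hxwu⟩ := exists_eq_div_of_ne_zero (R := R) hx0
  have hle := (h.isIntegral_div_iff hM hw hu).1 (hxwu ▸ x.2)
  obtain ⟨c, hc, hlt⟩ : ∃ c, Irreducible c ∧ rootOrd M c u < rootOrd M c w := by
    by_contra! hcon
    exact hx.not_isUnit (h.isUnit_of_rootOrd_eq hM hw hu hxwu
      fun c hc => le_antisymm (hle c hc) (hcon c hc))
  have hc' : algebraMap R K c ≠ 0 := by simpa using hc.ne_zero
  have hu' : algebraMap R K u ≠ 0 := by simpa using hu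
  have hMle : M + rootOrd M c u ≤ rootOrd M c w := by
    have := Nat.le_of_dvd (Nat.sub_pos_of_lt hlt)
      (Nat.dvd_sub (h.dvd_rootOrd hM hE hc hw).1 (h.dvd_rootOrd hM hE hc hu).1)
    omega
  have hint : IsIntegral R (algebraMap R K w / algebraMap R K (c * u)) := by
    refine (h.isIntegral_div_iff hM hw (mul_ne_zero hc.ne_zero hu)).2 fun d hd => ?_
    rw [h.rootOrd_mul hM hd hc.ne_zero hu]
    by_cases hdc : DvdPow d c
    · have hcd := h.dvdPow_symm hd hc hdc
      rw [(h.dvd_rootOrd hM hE hc hc.ne_zero).2 d hd hcd, (h.dvd_rootOrd hM hE hc hu).2 d hd hcd,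
        (h.dvd_rootOrd hM hE hc hw).2 d hd hcd, rootOrd_self hc]
      exact hMle
    · rw [rootOrd_of_not_dvdPow hd hdc, zero_add]
      exact hle d hd
  have hprod : x = algebraMap R (integralClosure R K) c * ⟨_, hint⟩ := by
    refine Subtype.ext ?_
    change (x : K) = algebraMap R K c * (algebraMap R K w / algebraMap R K (c * u))
    rw [hxwu, map_mul]
    field_simp
  exact ⟨c, ((hx.isUnit_or_isUnit hprod).resolve_left (h.not_isUnit_algebraMap hM hc)).unit, hc,
    hprod⟩

end HasPrimaryAtoms

end IntegralClosure

end FactorizationTheory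

/-! ### The equivalences -/

theorem mainTheorem5 {R : Type*} [CommRing R] [IsDomain R]
    {K : Type*} [Field K] [Algebra R K] [IsFractionRing R K]
    (hR : IsGeneralizedCohenKaplansky R) :
    List.TFAE
      [ IsTransferKrull R⁰,
        ∀ M : MaximalSpectrum R, IsTransferKrull (Localization.AtPrime M.asIdeal)⁰,
        ∀ M : MaximalSpectrum R, IsHalfFactorial (Localization.AtPrime M.asIdeal)⁰,
        IsHalfFactorial R⁰,
        {x : integralClosure R K | Irreducible x} =
          {x | ∃ (a : R) (ε : (integralClosure R K)ˣ), Irreducible a ∧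
            x = algebraMap R (integralClosure R K) a * ε},
        algebraMap R (integralClosure R K) '' {a : R | Irreducible a} ⊆
          {x : integralClosure R K | Irreducible x} ] ∧
    (IsSeminormal R⁰ →
      IsTransferKrull R⁰ ∧
      (∀ M : MaximalSpectrum R, IsTransferKrull (Localization.AtPrime M.asIdeal)⁰) ∧
      (∀ M : MaximalSpectrum R, IsHalfFactorial (Localization.AtPrime M.asIdeal)⁰) ∧
      IsHalfFactorial R⁰ ∧
      {x : integralClosure R K | Irreducible x} =
        {x | ∃ (a : R) (ε : (integralClosure R K)ˣ), Irreducible a ∧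
          x = algebraMap R (integralClosure R K) a * ε} ∧
      algebraMap R (integralClosure R K) '' {a : R | Irreducible a} ⊆
        {x : integralClosure R K | Irreducible x}) := by
  have h := hR.hasPrimaryAtoms
  obtain ⟨e, he⟩ := hR.exists_isCommonExponent
  -- Each condition is reached from `EqualExponents R`, and each gives it back.
  have sat : ∀ M : MaximalSpectrum R, ∀ x y : R,
      x * y ∈ M.asIdeal.primeCompl → x ∈ M.asIdeal.primeCompl :=
    fun M x y hxy hx => hxy (M.asIdeal.mul_mem_right y hx)
  have sat0 : ∀ M : MaximalSpectrum R, (0 : R) ∉ M.asIdeal.primeCompl :=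
    fun M h0 => h0 M.asIdeal.zero_mem
  have hloc : EqualExponents R →
      ∀ M : MaximalSpectrum R, IsHalfFactorial (Localization.AtPrime M.asIdeal)⁰ :=
    fun hE M => h.isHalfFactorial_of_equalExponents (sat M) (sat0 M) he hE
  have hglob : EqualExponents R → IsHalfFactorial R⁰ := fun hE =>
    h.isHalfFactorial_of_equalExponents (W := IsUnit.submonoid R)
      (fun x y hxy => isUnit_of_mul_isUnit_left hxy) (fun h0 => not_isUnit_zero h0) he hE
  have hclos : EqualExponents R → {x : integralClosure R K | Irreducible x} =
      {x | ∃ (a : R) (ε : (integralClosure R K)ˣ), Irreducible a ∧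
        x = algebraMap R (integralClosure R K) a * ε} := fun hE =>
    Set.Subset.antisymm (fun x hx => h.exists_eq_algebraMap_mul_unit he hE hx) (by
      rintro _ ⟨a, ε, ha, rfl⟩
      exact (irreducible_mul_units ε).2 (h.irreducible_algebraMap_integralClosure he hE ha))
  have h12 : (∀ M : MaximalSpectrum R, IsTransferKrull (Localization.AtPrime M.asIdeal)⁰) →
      EqualExponents R := by
    intro hM a b ha hb m n hm hn hab
    obtain ⟨I, hI, haI⟩ := exists_max_ideal_of_mem_nonunits ha.not_isUnit
    have hbI : b ∈ I := hI.isPrime.mem_of_pow_mem n (I.mem_of_dvd hab.dvd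
      (I.pow_mem_of_mem haI m hm))
    exact h.equalExponents_of_localization (sat ⟨I, hI⟩) (sat0 ⟨I, hI⟩)
      (equalExponents_nonZeroDivisors_iff.1 (hM ⟨I, hI⟩).equalExponents) ha hb
      (fun h' => h' haI) (fun h' => h' hbI) hm hn hab
  refine ⟨?_, fun hS => ?_⟩
  · tfae_have 1 → 6 := by
      rintro hT _ ⟨a, ha, rfl⟩
      exact h.irreducible_algebraMap_integralClosure he
        (equalExponents_nonZeroDivisors_iff.1 hT.equalExponents) ha
    tfae_have 6 → 3 := fun h6 => hloc (equalExponents_of_image_subset h6)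
    tfae_have 3 → 2 := fun h3 M => (h3 M).isTransferKrull
    tfae_have 2 → 4 := fun h2 => hglob (h12 h2)
    tfae_have 4 → 1 := fun h4 => h4.isTransferKrull
    tfae_have 6 → 5 := fun h6 => hclos (equalExponents_of_image_subset h6)
    tfae_have 5 → 6 := by
      rintro h5 _ ⟨a, ha, rfl⟩
      rw [h5]
      exact ⟨a, 1, ha, by simp⟩
    tfae_finish
  · have hE := equalExponents_nonZeroDivisors_iff.1 hS.equalExponents
    refine ⟨(hglob hE).isTransferKrull, fun M => (hloc hE M).isTransferKrull, hloc hE, hglob hE,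
      hclos hE, ?_⟩
    rintro _ ⟨a, ha, rfl⟩
    exact h.irreducible_algebraMap_integralClosure he hE ha
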